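/- **Setting.** Let $m\ge 1$, $\hbar>0$, let $K$ be a complex symmetric $2m\times 2m$ matrix, $J=\begin{bmatrix}0&-I\\ I&0\end{bmatrix}$, $\Lambda=K+J$, and write $\boldsymbol u=(\tilde u_1,\dots,\tilde u_m,\tilde v_1,\dots,\tilde v_m)$ for the coordinates of $\mathbb C^{2m}$. The $K$-ordered product $$f*_Kg=\sum_{n}\frac{(i\hbar)^n}{n!\,2^n}\sum\Lambda_{i_1j_1}\cdots\Lambda_{i_nj_n}\,\partial_{i_1}\cdots\partial_{i_n}f\;\partial_{j_1}\cdots\partial_{j_n}g$$ is defined when one factor is a polynomial and the other an entire function; it satisfies $[\tilde u_k,\tilde v_l]=-i\hbar\delta_{kl}$. Put $x\circ y=\frac12(x*_Ky+y*_Kx)$. For a polynomial $H$ and an entire function $F$ on $\mathbb C^{2m}$, $e_*^{tH}*F$ $(t\in\mathbb R)$ denotes the solution $\Phi_t$, real analytic in $(t,\boldsymbol u)$ and entire in $\boldsymbol u$, of $\frac{d}{dt}\Phi_t=H*_K\Phi_t$, $\Phi_0=F$, if it exists; it is unique. The parameter $K$ is assumed generic in the sense that the vacuum exists: $e_*^{t\frac1{i\hbar}\sum_j\tilde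 u_j*\tilde v_j}$ (initial value $1$) exists for all $t\in\mathbb R$ and converges locally uniformly, as $t\to-\infty$, to a function $\widetilde\varpi(L)$. The regular representation space with respect to $\widetilde\varpi(L)$ is the closure of $\mathbb C[\tilde u_1,\dots,\tilde u_m]*_K\widetilde\varpi(L)$ in the space of entire functions on $\mathbb C^{2m}$ (uniform convergence on compact sets). A *Hilbert space of elements of the regular representation space* is a complex Hilbert space $\mathcal H$ together with a linear subspace $D$ of the regular representation space and an injective linear map $D\to\mathcal H$ with dense range (so $D$ is regarded as a dense subspace of $\mathcal H$). The one-parameter family $e_*^{tH}$, $t\in\mathbb R$, is *regularly represented* on $\mathcal H$ (with domain $D$) if there is a strongly continuous one-parameter group $(U_t)_{t\in\mathbb R}$ of bounded (not necessarily unitary) operators on $\mathcal H$ such that for every $F\in D$: $e_*^{tH}*F$ exists and lies in $D$ for all $t\in\mathbb R$ and $U_tF=e_*^{tH}*F$; and $H*_KF\in D$ and $\frac{d}{dt}U_tF|_{t=0}=H*_KF$ in the norm of $\mathcal H$. **Theorem.** For every such $K$ and every $1\le k\le m$ there are no non-zero Hilbert space $\mathcal H$ of elements of the regular representation space with respect to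 $\widetilde\varpi(L)$ and no common domain $D$ on which all the star-exponentials $$e_*^{t\frac1{i\hbar}(a\tilde u_k^2+b\tilde v_k^2+2c\,\tilde u_k\circ\tilde v_k)},\qquad a,b,c\in\mathbb C,\quad ab-c^2=1,$$ (where $\tilde u_k^2=\tilde u_k*_K\tilde u_k$, $\tilde v_k^2=\tilde v_k*_K\tilde v_k$) are regularly represented. -/

import Mathlib

open Filter Topology

noncomputable section

/-- Phase space `ℂ^{2m}`: the coordinates `Sum.inl j` are the generators `ũ_j`, the coordinates
`Sum.inr j` are the generators `ṽ_j`. -/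
abbrev PhaseSpace (m : ℕ) : Type := Fin m ⊕ Fin m → ℂ

/-- The partial derivative `∂_{u_{s 0}} ⋯ ∂_{u_{s (n-1)}} f`. -/
def iterPartial {m n : ℕ} (s : Fin n → Fin m ⊕ Fin m) (f : PhaseSpace m → ℂ) :
    PhaseSpace m → ℂ :=
  fun u => iteratedFDeriv ℂ n f u (fun r => Pi.single (s r) 1)

/-- The `K`-ordered star product
`f *_K g = ∑_n (iħ)^n / (n! 2^n) ∑ Λ_{i₁j₁} ⋯ Λ_{iₙjₙ} (∂_{i₁} ⋯ ∂_{iₙ} f) (∂_{j₁} ⋯ ∂_{jₙ} g)`,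
`Λ = K + J`, where `J = [[0, -1], [1, 0]]`. It is only used when one factor is a polynomial, and
then only finitely many terms of the series are non-zero. -/
def starMul {m : ℕ} (ħ : ℝ) (K : Matrix (Fin m ⊕ Fin m) (Fin m ⊕ Fin m) ℂ)
    (f g : PhaseSpace m → ℂ) : PhaseSpace m → ℂ :=
  fun u => ∑' n : ℕ, (Complex.I * ħ) ^ n / ((n.factorial : ℂ) * 2 ^ n) *
    ∑ s : Fin n → Fin m ⊕ Fin m, ∑ t : Fin n → Fin m ⊕ Fin m,
      (∏ r, (K + Matrix.J (Fin m) ℂ) (s r) (t r)) * iterPartial s f u * iterPartial t g u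

/-- The generator `ũ_j`, as a function on phase space. -/
def genU {m : ℕ} (j : Fin m) : PhaseSpace m → ℂ := fun u => u (Sum.inl j)

/-- The generator `ṽ_j`, as a function on phase space. -/
def genV {m : ℕ} (j : Fin m) : PhaseSpace m → ℂ := fun u => u (Sum.inr j)

/-- The `K`-ordered expression of the quadratic form
`(1/iħ) (a ũ_k² + b ṽ_k² + 2c ũ_k ∘ ṽ_k)`, where squares are star squares and
`x ∘ y = (x * y + y * x) / 2`. -/
def quadForm {m : ℕ} (ħ : ℝ) (K : Matrix (Fin m ⊕ Fin m) (Fin m ⊕ Fin m) ℂ) (k : Fin m)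
    (a b c : ℂ) : PhaseSpace m → ℂ :=
  fun u => 1 / (Complex.I * ħ) *
    (a * starMul ħ K (genU k) (genU k) u + b * starMul ħ K (genV k) (genV k) u +
      2 * c * ((starMul ħ K (genU k) (genV k) u + starMul ħ K (genV k) (genU k) u) / 2))

/-- `Φ t = :e_*^{tH} * F:_K` for all real `t`: `Φ` is the (necessarily unique) real analytic
solution, with entire values, of the evolution equation `d/dt Φ_t = H *_K Φ_t`, `Φ_0 = F`.
Here `H` is the `K`-ordered expression of a polynomial. -/
structure IsStarExp {m : ℕ} (ħ : ℝ) (K : Matrix (Fin m ⊕ Fin m) (Fin m ⊕ Fin m) ℂ)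
    (H F : PhaseSpace m → ℂ) (Φ : ℝ → PhaseSpace m → ℂ) : Prop where
  analytic : AnalyticOnNhd ℝ (fun z : ℝ × PhaseSpace m => Φ z.1 z.2) Set.univ
  entire : ∀ t, Differentiable ℂ (Φ t)
  initial : Φ 0 = F
  evolution : ∀ t u, HasDerivAt (fun s : ℝ => Φ s u) (starMul ħ K H (Φ t) u) t

/-- `ϖ` is the `K`-ordered expression of the (total, standard) vacuum
`lim_{t → -∞} e_*^{t (1/iħ) ∑_j ũ_j * ṽ_j}`. In particular the star exponential has no singular
point on the real line and the limit exists (uniformly on compact sets). -/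
def IsVacuum {m : ℕ} (ħ : ℝ) (K : Matrix (Fin m ⊕ Fin m) (Fin m ⊕ Fin m) ℂ)
    (ϖ : PhaseSpace m → ℂ) : Prop :=
  ∃ E : ℝ → PhaseSpace m → ℂ,
    IsStarExp ħ K
      (fun u => 1 / (Complex.I * ħ) * ∑ j : Fin m, starMul ħ K (genU j) (genV j) u)
      (fun _ => 1) E ∧
    TendstoLocallyUniformly E ϖ atBot

/-- The regular representation space with respect to `ϖ`, in `K`-ordered expression: the entire
functions which are limits, uniformly on compact sets, of elements of `ℂ[ũ] * ϖ`. -/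
def regularSpace {m : ℕ} (ħ : ℝ) (K : Matrix (Fin m ⊕ Fin m) (Fin m ⊕ Fin m) ℂ)
    (ϖ : PhaseSpace m → ℂ) : Set (PhaseSpace m → ℂ) :=
  {F | Differentiable ℂ F ∧ ∀ S : Set (PhaseSpace m), IsCompact S → ∀ ε : ℝ, 0 < ε →
    ∃ p : MvPolynomial (Fin m) ℂ, ∀ u ∈ S,
      ‖F u - starMul ħ K (fun x => MvPolynomial.eval (fun j => genU j x) p) ϖ u‖ < ε}

/-- A Hilbert space of elements of the regular representation space: `𝓗` contains, through the
injection `ι`, a dense linear subspace `D` of the regular representation space. -/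
structure IsRegularHilbertSpace {m : ℕ} (ħ : ℝ)
    (K : Matrix (Fin m ⊕ Fin m) (Fin m ⊕ Fin m) ℂ) (ϖ : PhaseSpace m → ℂ)
    {𝓗 : Type*} [NormedAddCommGroup 𝓗] [InnerProductSpace ℂ 𝓗]
    (D : Submodule ℂ (PhaseSpace m → ℂ)) (ι : D →ₗ[ℂ] 𝓗) : Prop where
  subset : (D : Set (PhaseSpace m → ℂ)) ⊆ regularSpace ħ K ϖ
  injective : Function.Injective ι
  dense : DenseRange ι

/-- The one-parameter family `e_*^{tH}`, `t ∈ ℝ`, is regularly represented on `𝓗`: there is a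
strongly continuous one-parameter group `U` of bounded operators on `𝓗` which on `D` is left star
multiplication by `e_*^{tH}`, and whose infinitesimal generator on `D` is left star
multiplication by `H` (that is, the Schrödinger equation of `H` holds in `𝓗`). The group `U` is
not required to be unitary. -/
def IsRegularlyRepresented {m : ℕ} (ħ : ℝ)
    (K : Matrix (Fin m ⊕ Fin m) (Fin m ⊕ Fin m) ℂ) (H : PhaseSpace m → ℂ)
    {𝓗 : Type*} [NormedAddCommGroup 𝓗] [InnerProductSpace ℂ 𝓗]
    (D : Submodule ℂ (PhaseSpace m → ℂ)) (ι : D →ₗ[ℂ] 𝓗) : Prop :=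
  ∃ U : ℝ → 𝓗 →L[ℂ] 𝓗,
    U 0 = ContinuousLinearMap.id ℂ 𝓗 ∧
    (∀ s t, U (s + t) = (U s).comp (U t)) ∧
    (∀ x, Continuous fun t => U t x) ∧
    (∀ F : D, ∃ Φ : ℝ → D,
      IsStarExp ħ K H (F : PhaseSpace m → ℂ) (fun t => (Φ t : PhaseSpace m → ℂ)) ∧
      ∀ t, U t (ι F) = ι (Φ t)) ∧
    (∀ F : D, ∃ G : D,
      (G : PhaseSpace m → ℂ) = starMul ħ K H (F : PhaseSpace m → ℂ) ∧
      HasDerivAt (fun t : ℝ => U t (ι F)) (ι G) 0)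

end

/-! For real unit vectors `n` of `ℝ³`, the choice `a = n 0 + i n 1`, `b = n 0 - i n 1`, `c = i n 2`
gives `ab - c² = |n|² = 1`. The corresponding quadratic forms `X n` satisfy `[X n, X n'] = 4 X (n ×
n')` and `∑ X(eᵢ)² = 3` (`sphereQuad_comm`, `sphereQuad_casimir`). They thus span a copy of `𝔰𝔲(2)`
with positive Casimir scalar, whereas a compact group acting on a Hilbert space forces a nonpositive
one. The contradiction comes from making this precise without assuming unitarity and without
constructing a representation of `SU(2)`.

Analytic uniqueness of the star evolution gives the relation `e^{t X v} X a = X(R a) e^{t X v}` on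
single orbits, for `a` orthogonal to `v` and `R` the rotation about `v` by `4t`
(`evolution_sphereQuad`). Uniqueness for the Cauchy problem turns it into conjugation relations
between the bounded groups (`IsSphereRep.conj`). Hence all `U a s` with `|s| ≤ π` are uniformly
bounded. Moreover the products of a half turn with an inverse half turn, which play the role of the
elements of `SU(2)`, are stable under right multiplication by every `U x t` (`exists_quot_mul`).

Finally there is a maximum principle (`not_nontrivial`). Let `M` be the supremum of `‖Q x‖` over
these products `Q`, for a fixed nonzero `x` from the domain. Since `∑ (U eᵢ t + U eᵢ (-t)) x = (6 +
3t²) x + o(t²)`, applying `Q` gives `(6 + 3t²) M ≤ 6M + o(t²)`, which is impossible for `M > 0`. -/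

/-! ### One-parameter groups of bounded operators -/

/-- A strongly continuous one-parameter group of bounded operators. -/
structure IsContGroup {𝓗 : Type*} [NormedAddCommGroup 𝓗] [NormedSpace ℂ 𝓗]
    (U : ℝ → 𝓗 →L[ℂ] 𝓗) : Prop where
  zero : U 0 = 1
  add : ∀ s t, U (s + t) = U s * U t
  cont : ∀ x, Continuous fun t => U t x

namespace IsContGroup

variable {𝓗 : Type*} [NormedAddCommGroup 𝓗] [NormedSpace ℂ 𝓗]
  {U : ℝ → 𝓗 →L[ℂ] 𝓗}

theorem add_apply (hU : IsContGroup U) (s t : ℝ) (x : 𝓗) : U (s + t) x = U s (U t x) := by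
  rw [hU.add]; rfl

theorem mul_neg (hU : IsContGroup U) (t : ℝ) : U t * U (-t) = 1 := by
  rw [← hU.add, add_neg_cancel, hU.zero]

theorem neg_mul (hU : IsContGroup U) (t : ℝ) : U (-t) * U t = 1 := by
  rw [← hU.add, neg_add_cancel, hU.zero]

theorem exists_bound [CompleteSpace 𝓗] (hU : IsContGroup U) {S : Set ℝ} (hS : IsCompact S) :
    ∃ C, 0 ≤ C ∧ ∀ t ∈ S, ‖U t‖ ≤ C := by
  obtain ⟨C, hC⟩ := banach_steinhaus (g := fun t : S => U t) (fun x => by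
    obtain ⟨C, hC⟩ := (hS.image (hU.cont x)).isBounded.exists_norm_le
    exact ⟨C, fun t => hC _ ⟨t, t.2, rfl⟩⟩)
  exact ⟨max C 0, le_max_right _ _, fun t ht => (hC ⟨t, ht⟩).trans (le_max_left _ _)⟩

theorem hasDerivAt (hU : IsContGroup U) {x y : 𝓗} (h : HasDerivAt (fun t => U t x) y 0) (t : ℝ) :
    HasDerivAt (fun s => U s x) (U t y) t := by
  have h1 : HasDerivAt (fun s : ℝ => s - t) 1 t := (hasDerivAt_id t).sub_const t
  have h2 : HasDerivAt (fun s => U (s - t) x) y t := by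
    have := HasDerivAt.scomp (h := fun s : ℝ => s - t) (g₁ := fun t => U t x) (g₁' := y) t
      (by simpa using h) h1
    simpa [Function.comp_def] using this
  have h3 := ((U t).restrictScalars ℝ).hasFDerivAt.comp_hasDerivAt t h2
  refine h3.congr_of_eventuallyEq (Eventually.of_forall fun s => ?_)
  simp [← hU.add_apply]

/-- Uniqueness for the abstract Cauchy problem along a curve. -/
theorem eq_of_hasDerivAt [CompleteSpace 𝓗] (hU : IsContGroup U) {g : ℝ → 𝓗} {g' : ℝ → 𝓗}
    (hg : ∀ s, HasDerivAt g (g' s) s) (hU' : ∀ s, HasDerivAt (fun t => U t (g s)) (g' s) 0)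
    (s : ℝ) : g s = U s (g 0) := by
  have key : ∀ s, HasDerivAt (fun r => U (-r) (g r)) 0 s := by
    intro s
    rw [hasDerivAt_iff_isLittleO_nhds_zero]
    have h1 := (hasDerivAt_iff_isLittleO_nhds_zero.1 (hg s)).sub
      (hasDerivAt_iff_isLittleO_nhds_zero.1 (hU' s))
    obtain ⟨C, hC0, hC⟩ := hU.exists_bound (isCompact_Icc (a := -s - 1) (b := -s + 1))
    refine Asymptotics.IsBigO.trans_isLittleO ?_ h1
    refine Asymptotics.IsBigO.of_bound C ?_
    filter_upwards [Icc_mem_nhds (show (-1 : ℝ) < 0 by norm_num) (show (0 : ℝ) < 1 by norm_num)]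
      with h hh
    -- Factoring out `U (-(s + h))` leaves the difference of two first-order remainders at `s`;
    -- local boundedness of the group then replaces a product rule in operator norm.
    have e : U (-(s + h)) (g (s + h)) - U (-s) (g s) - h • (0 : 𝓗) =
        U (-(s + h)) (g (s + h) - g s - h • g' s - (U (0 + h) (g s) - U 0 (g s) - h • g' s)) := by
      have : U (-s) (g s) = U (-(s + h)) (U h (g s)) := by
        rw [← hU.add_apply]; congr 2; ring
      rw [this, hU.zero]
      simp
    rw [e]
    exact (ContinuousLinearMap.le_opNorm _ _).trans (mul_le_mul_of_nonneg_right
      (hC _ ⟨by linarith [hh.2], by linarith [hh.1]⟩) (norm_nonneg _))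
  have hc := is_const_of_deriv_eq_zero (fun s => (key s).differentiableAt)
    (fun s => (key s).deriv) s 0
  simp only [neg_zero, hU.zero, one_apply_eq_self] at hc
  rw [← hc, ← hU.add_apply, add_neg_cancel, hU.zero]; rfl

/-- Second order symmetric difference quotient of a twice differentiable orbit. -/
theorem symm_diff_isLittleO (hU : IsContGroup U) {x y z : 𝓗}
    (h1 : HasDerivAt (fun t => U t x) y 0) (h2 : HasDerivAt (fun t => U t y) z 0) :
    (fun t : ℝ => U t x + U (-t) x - (2 : ℝ) • x - t ^ 2 • z) =o[𝓝 0] fun t => t ^ 2 := by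
  set f : ℝ → 𝓗 := fun t => U t x + U (-t) x - (2 : ℝ) • x - t ^ 2 • z with hf
  set f' : ℝ → 𝓗 := fun t => U t y - U (-t) y - (2 * t) • z with hf'
  have hd : ∀ t, HasDerivAt f (f' t) t := by
    intro t
    have a1 := hU.hasDerivAt h1 t
    have a2 : HasDerivAt (fun t => U (-t) x) (-(U (-t) y)) t := by
      have := HasDerivAt.scomp t (hU.hasDerivAt h1 (-t)) (hasDerivAt_neg t)
      simpa [Function.comp_def] using this
    have a3 : HasDerivAt (fun t : ℝ => t ^ 2 • z) ((2 * t) • z) t := by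
      simpa using (hasDerivAt_pow 2 t).smul_const z
    refine (((a1.fun_add a2).sub_const ((2 : ℝ) • x)).fun_sub a3).congr_deriv ?_
    simp [hf', sub_eq_add_neg]
  have hf0 : f 0 = 0 := by simp [hf, hU.zero, two_smul]
  have ho : f' =o[𝓝 0] fun t => t := by
    have b1 := hasDerivAt_iff_isLittleO_nhds_zero.1 h2
    have b2 : (fun h : ℝ => U (-h) y - y + h • z) =o[𝓝 0] fun h => h := by
      have a2 : HasDerivAt (fun t => U (-t) y) (-z) 0 := by
        have := HasDerivAt.scomp (h := fun t : ℝ => -t) (g₁ := fun t => U t y) (g₁' := z)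
          (0 : ℝ) (by simpa using h2) (hasDerivAt_neg 0)
        simpa [Function.comp_def] using this
      simpa [hU.zero] using hasDerivAt_iff_isLittleO_nhds_zero.1 a2
    refine (b1.sub b2).congr_left fun t => ?_
    simp only [hf', zero_add, hU.zero, one_apply_eq_self]
    module
  rw [Asymptotics.isLittleO_iff] at ho ⊢
  intro c hc
  obtain ⟨δ, hδ, H⟩ := Metric.eventually_nhds_iff.1 (ho hc)
  refine Metric.eventually_nhds_iff.2 ⟨δ, hδ, fun t ht => ?_⟩
  -- The derivative is `o(t)`, so the mean value inequality on the segment from `0` to `t` gains the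
  -- second factor `t`.
  have hb : ∀ r ∈ Set.uIcc 0 t, ‖f' r‖ ≤ c * |t| := by
    intro r hr
    have hrt : |r| ≤ |t| := by
      simpa using Set.abs_sub_left_of_mem_uIcc hr
    have : dist r 0 < δ := by
      rw [dist_zero_right, Real.norm_eq_abs] at *
      exact hrt.trans_lt ht
    refine (H this).trans ?_
    rw [Real.norm_eq_abs]
    gcongr
  have := Convex.norm_image_sub_le_of_norm_hasDerivWithin_le (s := Set.uIcc 0 t)
    (fun r _ => (hd r).hasDerivWithinAt) hb (convex_uIcc 0 t) Set.left_mem_uIcc Set.right_mem_uIcc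
  rw [hf0, sub_zero, sub_zero, Real.norm_eq_abs] at this
  refine this.trans (le_of_eq ?_)
  rw [norm_pow, Real.norm_eq_abs]; ring

end IsContGroup

/-! ### Rotations of `ℝ³` -/

open Matrix in
/-- Rotation by the angle `θ` around the unit vector `v` of a vector `a` orthogonal to `v`. -/
noncomputable def perpRot (v a : Fin 3 → ℝ) (θ : ℝ) : Fin 3 → ℝ :=
  Real.cos θ • a + Real.sin θ • (v ⨯₃ a)

section perpRot

open Matrix

variable {v a : Fin 3 → ℝ}

theorem dotProduct_perpRot (hva : v ⬝ᵥ a = 0) (θ : ℝ) : v ⬝ᵥ perpRot v a θ = 0 := by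
  simp [perpRot, dotProduct_add, dotProduct_smul, hva]

theorem perpRot_dotProduct_self (hv : v ⬝ᵥ v = 1) (ha : a ⬝ᵥ a = 1) (hva : v ⬝ᵥ a = 0) (θ : ℝ) :
    perpRot v a θ ⬝ᵥ perpRot v a θ = 1 := by
  have h1 : (v ⨯₃ a) ⬝ᵥ (v ⨯₃ a) = 1 := by
    rw [cross_dot_cross, hv, ha, hva]; simp
  have h2 : a ⬝ᵥ (v ⨯₃ a) = 0 := dot_cross_self v a
  have h3 : (v ⨯₃ a) ⬝ᵥ a = 0 := by rw [dotProduct_comm, h2]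
  simp only [perpRot, dotProduct_add, add_dotProduct, dotProduct_smul, smul_dotProduct, ha, h1, h2,
    h3, smul_eq_mul]
  nlinarith [Real.sin_sq_add_cos_sq θ]

theorem perpRot_pi : perpRot v a Real.pi = -a := by simp [perpRot]

theorem perpRot_neg_pi : perpRot v a (-Real.pi) = -a := by simp [perpRot]

/-- A kernel vector of a matrix with a repeated row is used instead of `a × b`, so that parallel `a`
and `b` are covered. -/
theorem exists_unit_perp (a b : Fin 3 → ℝ) :
    ∃ v : Fin 3 → ℝ, v ⬝ᵥ v = 1 ∧ v ⬝ᵥ a = 0 ∧ v ⬝ᵥ b = 0 := by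
  have hdet : (Matrix.of ![a, b, b]).det = 0 :=
    Matrix.det_zero_of_row_eq (i := 1) (j := 2) (by decide) rfl
  obtain ⟨w, hw, h⟩ := Matrix.exists_mulVec_eq_zero_iff.2 hdet
  have ha : w ⬝ᵥ a = 0 := by
    rw [dotProduct_comm]; simpa [Matrix.mulVec] using congrFun h 0
  have hb : w ⬝ᵥ b = 0 := by
    rw [dotProduct_comm]; simpa [Matrix.mulVec] using congrFun h 1
  have hpos : 0 < w ⬝ᵥ w :=
    lt_of_le_of_ne (Finset.sum_nonneg fun i _ => mul_self_nonneg _)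
      fun h => hw (dotProduct_self_eq_zero.1 h.symm)
  refine ⟨(Real.sqrt (w ⬝ᵥ w))⁻¹ • w, ?_, by simp [ha], by simp [hb]⟩
  have := Real.mul_self_sqrt hpos.le
  have h0 := (Real.sqrt_pos.2 hpos).ne'
  simp only [smul_dotProduct, dotProduct_smul, smul_eq_mul]
  field_simp
  nlinarith

theorem exists_angle (α β : ℝ) : ∃ θ : ℝ, Real.cos θ * α + Real.sin θ * β = 0 := by
  by_cases hz : (⟨β, -α⟩ : ℂ) = 0
  · have h1 : β = 0 := congrArg Complex.re hz
    have h2 : -α = 0 := congrArg Complex.im hz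
    exact ⟨0, by simp [neg_eq_zero.1 h2, h1]⟩
  · refine ⟨Complex.arg ⟨β, -α⟩, ?_⟩
    have h1 := Complex.norm_mul_cos_arg ⟨β, -α⟩
    have h2 := Complex.norm_mul_sin_arg ⟨β, -α⟩
    have h3 := norm_ne_zero_iff.2 hz
    refine mul_left_cancel₀ h3 ?_
    simp only at h1 h2
    linear_combination α * h1 + β * h2

/-- Spherical coordinates. -/
theorem exists_spherical (ha : a ⬝ᵥ a = 1) : ∃ r ∈ Set.Icc (-Real.pi) Real.pi,
    ∃ θ ∈ Set.Icc (-Real.pi) Real.pi,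
      a = perpRot (perpRot (Pi.single 2 1) (Pi.single 0 1) r) (Pi.single 2 1) θ := by
  have hs : a 0 ^ 2 + a 1 ^ 2 + a 2 ^ 2 = 1 := by
    rw [← ha]; simp [dotProduct, Fin.sum_univ_three]; ring
  -- The target formula has horizontal part `sin θ (sin r, -cos r)`, so `-a 1 + i a 0 = sin θ ·
  -- e^{ir}` with `θ = arccos (a 2)`.
  set z : ℂ := ⟨-a 1, a 0⟩ with hz
  have hn : Real.sin (Real.arccos (a 2)) = ‖z‖ := by
    rw [Real.sin_arccos, Complex.norm_eq_sqrt_sq_add_sq]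
    congr 1
    simp only [hz]
    linarith
  have h1 := Complex.norm_mul_cos_arg z
  have h2 := Complex.norm_mul_sin_arg z
  rw [← hn] at h1 h2
  have h3 : Real.cos (Real.arccos (a 2)) = a 2 :=
    Real.cos_arccos (by nlinarith [sq_nonneg (a 0), sq_nonneg (a 1)])
      (by nlinarith [sq_nonneg (a 0), sq_nonneg (a 1)])
  refine ⟨z.arg, ⟨(Complex.neg_pi_lt_arg z).le, Complex.arg_le_pi z⟩, Real.arccos (a 2),
    ⟨by linarith [Real.arccos_nonneg (a 2), Real.pi_pos], Real.arccos_le_pi _⟩, ?_⟩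
  ext i
  fin_cases i <;> simp [perpRot, cross_apply, vecHead, vecTail, h3] <;> simp [hz] at h1 h2 ⊢ <;>
    linarith

end perpRot

/-! ### Integrated `𝔰𝔲(2)` relations and the maximum principle -/

open Matrix in
/-- One-parameter groups `U n`, indexed by the unit vectors `n` of `ℝ³`, with generators `T n` on a
common invariant domain, on which the relations of `𝔰𝔲(2)` are integrated along single orbits
and the Casimir operator is the scalar `3`. -/
structure IsSphereRep {𝓗 D : Type*} [NormedAddCommGroup 𝓗] [NormedSpace ℂ 𝓗] [AddCommGroup D]
    [Module ℂ D] (ι : D →ₗ[ℂ] 𝓗) (U : (Fin 3 → ℝ) → ℝ → 𝓗 →L[ℂ] 𝓗)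
    (T : (Fin 3 → ℝ) → D → D) (Φ : (Fin 3 → ℝ) → D → ℝ → D) : Prop where
  dense : DenseRange ι
  group : ∀ n, n ⬝ᵥ n = 1 → IsContGroup (U n)
  orbit : ∀ n, n ⬝ᵥ n = 1 → ∀ F t, U n t (ι F) = ι (Φ n F t)
  deriv : ∀ n, n ⬝ᵥ n = 1 → ∀ F, HasDerivAt (fun t => U n t (ι F)) (ι (T n F)) 0
  neg : ∀ n, n ⬝ᵥ n = 1 → ∀ F, ι (T (-n) F) = -ι (T n F)
  intertwine : ∀ v a, v ⬝ᵥ v = 1 → a ⬝ᵥ a = 1 → v ⬝ᵥ a = 0 → ∀ F t,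
    ι (Φ v (T a F) t) = ι (T (perpRot v a (4 * t)) (Φ v F t))
  casimir : ∀ F, ∑ i : Fin 3, ι (T (Pi.single i 1) (T (Pi.single i 1) F)) = (3 : ℝ) • ι F

namespace IsSphereRep

open Matrix

variable {𝓗 D : Type*} [NormedAddCommGroup 𝓗] [NormedSpace ℂ 𝓗] [AddCommGroup D]
    [Module ℂ D] {ι : D →ₗ[ℂ] 𝓗} {U : (Fin 3 → ℝ) → ℝ → 𝓗 →L[ℂ] 𝓗}
    {T : (Fin 3 → ℝ) → D → D} {Φ : (Fin 3 → ℝ) → D → ℝ → D}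

theorem ext_on (h : IsSphereRep ι U T Φ) {A B : 𝓗 →L[ℂ] 𝓗} (H : ∀ F, A (ι F) = B (ι F)) :
    A = B :=
  ContinuousLinearMap.coeFn_injective
    (h.dense.equalizer A.continuous B.continuous (funext H))

/-- Differentiate the two factorizations of `U n (r + s)` on the orbit at `r = 0`. -/
theorem map_gen (h : IsSphereRep ι U T Φ) {n : Fin 3 → ℝ} (hn : n ⬝ᵥ n = 1) (F : D) (s : ℝ) :
    U n s (ι (T n F)) = ι (T n (Φ n F s)) := by
  have hU := h.group n hn
  have h1 := ((U n s).restrictScalars ℝ).hasFDerivAt.comp_hasDerivAt 0 (h.deriv n hn F)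
  refine HasDerivAt.unique h1 ((h.deriv n hn (Φ n F s)).congr_of_eventuallyEq
    (Eventually.of_forall fun r => ?_))
  simp only [Function.comp, ContinuousLinearMap.coe_restrictScalars']
  rw [← h.orbit n hn, ← hU.add_apply, ← hU.add_apply, add_comm]

theorem single_dotProduct_self (i : Fin 3) :
    (Pi.single i 1 : Fin 3 → ℝ) ⬝ᵥ Pi.single i 1 = 1 := by simp

theorem symm_sum_isLittleO (h : IsSphereRep ι U T Φ) (F : D) :
    (fun t : ℝ => ∑ i : Fin 3, (U (Pi.single i 1) t (ι F) + U (Pi.single i 1) (-t) (ι F)) -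
      (6 + 3 * t ^ 2) • ι F) =o[𝓝 0] fun t => t ^ 2 := by
  have := Asymptotics.IsLittleO.sum (s := Finset.univ) fun (i : Fin 3) _ =>
    (h.group _ (single_dotProduct_self i)).symm_diff_isLittleO
      (h.deriv _ (single_dotProduct_self i) F) (h.deriv _ (single_dotProduct_self i) _)
  refine this.congr_left fun t => ?_
  rw [Finset.sum_apply, Finset.sum_sub_distrib, Finset.sum_sub_distrib, ← Finset.smul_sum, ← Finset.smul_sum, h.casimir]
  simp only [Finset.sum_const, Finset.card_univ, Fintype.card_fin]
  module

variable [CompleteSpace 𝓗]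

/-- As a function of `s`, the left side applied to `ι F` stays in the domain by `orbit`, and
`intertwine` identifies its derivative with the generator of the rotated group. Uniqueness of the
Cauchy problem and density conclude. -/
theorem conj (h : IsSphereRep ι U T Φ) {v a : Fin 3 → ℝ} (hv : v ⬝ᵥ v = 1) (ha : a ⬝ᵥ a = 1)
    (hva : v ⬝ᵥ a = 0) (t s : ℝ) :
    U v t * U a s = U (perpRot v a (4 * t)) s * U v t := by
  have ha' := perpRot_dotProduct_self hv ha hva (4 * t)
  refine h.ext_on fun F => ?_
  have := (h.group _ ha').eq_of_hasDerivAt (g := fun s => U v t (U a s (ι F)))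
    (g' := fun s => U v t (U a s (ι (T a F))))
    (fun s => ((U v t).restrictScalars ℝ).hasFDerivAt.comp_hasDerivAt s
      ((h.group a ha).hasDerivAt (h.deriv a ha F) s))
    (fun s => by
      rw [h.orbit a ha, h.orbit v hv, h.map_gen ha, h.orbit v hv, h.intertwine v a hv ha hva]
      exact h.deriv _ ha' _) s
  simpa [(h.group a ha).zero] using this

theorem neg_eq (h : IsSphereRep ι U T Φ) {a : Fin 3 → ℝ} (ha : a ⬝ᵥ a = 1) (s : ℝ) :
    U (-a) s = U a (-s) := by
  have ha' : (-a) ⬝ᵥ (-a) = 1 := by simpa using ha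
  refine h.ext_on fun F => ?_
  have := (h.group _ ha').eq_of_hasDerivAt (g := fun s => U a (-s) (ι F))
    (g' := fun s => -U a (-s) (ι (T a F)))
    (fun s => by
      have := HasDerivAt.scomp s ((h.group a ha).hasDerivAt (h.deriv a ha F) (-s))
        (hasDerivAt_neg s)
      simpa [Function.comp_def] using this)
    (fun s => by
      rw [h.orbit a ha, h.map_gen ha, ← h.neg a ha]
      exact h.deriv _ ha' _) s
  simpa [(h.group a ha).zero] using this.symm

/-- Conjugation rotates at speed `4`, so time `π / 4` is a half turn about `a`, which reverses every
axis orthogonal to `a`. -/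
theorem halfTurn_mul (h : IsSphereRep ι U T Φ) {v a : Fin 3 → ℝ} (hv : v ⬝ᵥ v = 1)
    (ha : a ⬝ᵥ a = 1) (hva : v ⬝ᵥ a = 0) (s : ℝ) :
    U a (Real.pi / 4) * U v s = U v (-s) * U a (Real.pi / 4) := by
  rw [h.conj ha hv (by rw [dotProduct_comm, hva]), show 4 * (Real.pi / 4) = Real.pi by ring,
    perpRot_pi, h.neg_eq hv]

theorem halfTurn_inv_mul (h : IsSphereRep ι U T Φ) {v a : Fin 3 → ℝ} (hv : v ⬝ᵥ v = 1)
    (ha : a ⬝ᵥ a = 1) (hva : v ⬝ᵥ a = 0) (s : ℝ) :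
    U a (-(Real.pi / 4)) * U v s = U v (-s) * U a (-(Real.pi / 4)) := by
  rw [h.conj ha hv (by rw [dotProduct_comm, hva]), show 4 * -(Real.pi / 4) = -Real.pi by ring,
    perpRot_neg_pi, h.neg_eq hv]

/-- The quotient of two half turns. -/
noncomputable def quot (U : (Fin 3 → ℝ) → ℝ → 𝓗 →L[ℂ] 𝓗) (a b : Fin 3 → ℝ) : 𝓗 →L[ℂ] 𝓗 :=
  U a (Real.pi / 4) * U b (-(Real.pi / 4))

/-- Conjugating by `U v` rotates both axes together, yet `U v` commutes with the quotient, because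
each of the two half turns inverts it. Only the relative position of the axes matters. -/
theorem quot_perpRot (h : IsSphereRep ι U T Φ) {v a b : Fin 3 → ℝ} (hv : v ⬝ᵥ v = 1)
    (ha : a ⬝ᵥ a = 1) (hb : b ⬝ᵥ b = 1) (hva : v ⬝ᵥ a = 0) (hvb : v ⬝ᵥ b = 0) (θ : ℝ) :
    quot U (perpRot v a θ) (perpRot v b θ) = quot U a b := by
  obtain ⟨r, rfl⟩ : ∃ r, θ = 4 * r := ⟨θ / 4, by ring⟩
  have h1 : quot U (perpRot v a (4 * r)) (perpRot v b (4 * r)) * U v r = U v r * quot U a b := by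
    rw [quot, quot, mul_assoc, ← h.conj hv hb hvb, ← mul_assoc, ← h.conj hv ha hva, mul_assoc]
  have h2 : quot U a b * U v r = U v r * quot U a b := by
    rw [quot, mul_assoc, h.halfTurn_inv_mul hv hb hvb, ← mul_assoc, h.halfTurn_mul hv ha hva,
      neg_neg, mul_assoc]
  have h3 := congrArg (· * U v (-r)) (h1.trans h2.symm)
  simpa only [mul_assoc, (h.group v hv).mul_neg, mul_one] using h3

/-- Split `U x t` into two halves and move one through the inverse half turn, which inverts it: what
remains is a conjugation by `U x (-(t / 2))`, hence a rotated axis. -/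
theorem quot_mul_of_perp (h : IsSphereRep ι U T Φ) {a b x : Fin 3 → ℝ}
    (hb : b ⬝ᵥ b = 1) (hx : x ⬝ᵥ x = 1) (hxb : x ⬝ᵥ b = 0) (t : ℝ) :
    quot U a b * U x t = quot U a (perpRot x b (4 * (-(t / 2)))) := by
  have e : U b (-(Real.pi / 4)) * U x t = U (perpRot x b (4 * (-(t / 2)))) (-(Real.pi / 4)) := by
    have h1 : U x t = U x (t / 2) * U x (t / 2) := by rw [← (h.group x hx).add, add_halves]
    rw [h1, ← mul_assoc, h.halfTurn_inv_mul hx hb hxb, h.conj hx hb hxb, mul_assoc,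
      (h.group x hx).neg_mul, mul_one]
  rw [quot, mul_assoc, e, quot]

/-- The quotients of half turns are stable under right multiplication by all the groups. -/
theorem exists_quot_mul (h : IsSphereRep ι U T Φ) {a b x : Fin 3 → ℝ} (ha : a ⬝ᵥ a = 1)
    (hb : b ⬝ᵥ b = 1) (hx : x ⬝ᵥ x = 1) (t : ℝ) :
    ∃ a' b', a' ⬝ᵥ a' = 1 ∧ b' ⬝ᵥ b' = 1 ∧ quot U a b * U x t = quot U a' b' := by
  -- The pair is turned within its plane until its second axis is orthogonal to `x`; the quotient
  -- does not change.
  obtain ⟨v, hv, hva, hvb⟩ := exists_unit_perp a b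
  obtain ⟨θ, hθ⟩ := exists_angle (x ⬝ᵥ b) (x ⬝ᵥ (v ⨯₃ b))
  have hxb : x ⬝ᵥ perpRot v b θ = 0 := by
    simpa [perpRot, dotProduct_add, dotProduct_smul] using hθ
  have hb' := perpRot_dotProduct_self hv hb hvb θ
  rw [← h.quot_perpRot hv ha hb hva hvb θ, h.quot_mul_of_perp hb' hx hxb]
  exact ⟨_, _, perpRot_dotProduct_self hv ha hva θ, perpRot_dotProduct_self hx hb' hxb _, rfl⟩

/-- Banach–Steinhaus only bounds one axis at a time. Spherical coordinates reach every axis from two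
fixed ones by two conjugations with operators whose times lie in a compact interval. -/
theorem exists_bound (h : IsSphereRep ι U T Φ) : ∃ C, 0 ≤ C ∧
    ∀ a, a ⬝ᵥ a = 1 → ∀ s ∈ Set.Icc (-Real.pi) Real.pi, ‖U a s‖ ≤ C := by
  have hK : IsCompact (Set.Icc (-Real.pi) Real.pi) := isCompact_Icc
  have hdiv : ∀ r ∈ Set.Icc (-Real.pi) Real.pi, r / 4 ∈ Set.Icc (-Real.pi) Real.pi ∧
      -(r / 4) ∈ Set.Icc (-Real.pi) Real.pi := fun r hr => by
    have := Real.pi_pos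
    exact ⟨⟨by linarith [hr.1], by linarith [hr.2]⟩, ⟨by linarith [hr.2], by linarith [hr.1]⟩⟩
  have conj_bound : ∀ {v a : Fin 3 → ℝ} {C C' : ℝ}, v ⬝ᵥ v = 1 → a ⬝ᵥ a = 1 → v ⬝ᵥ a = 0 →
      0 ≤ C → 0 ≤ C' →
      (∀ s ∈ Set.Icc (-Real.pi) Real.pi, ‖U v s‖ ≤ C) →
      (∀ s ∈ Set.Icc (-Real.pi) Real.pi, ‖U a s‖ ≤ C') →
      ∀ r ∈ Set.Icc (-Real.pi) Real.pi, ∀ s ∈ Set.Icc (-Real.pi) Real.pi,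
        ‖U (perpRot v a r) s‖ ≤ C * C' * C := by
    intro v a C C' hv ha hva hC hC' H H' r hr s hs
    have e : U (perpRot v a r) s = U v (r / 4) * U a s * U v (-(r / 4)) := by
      rw [h.conj hv ha hva, mul_assoc, (h.group v hv).mul_neg, mul_one]
      congr 2; ring
    rw [e]
    refine (norm_mul_le _ _).trans (mul_le_mul ((norm_mul_le _ _).trans ?_)
      (H _ (hdiv r hr).2) (norm_nonneg _) (by positivity))
    exact mul_le_mul (H _ (hdiv r hr).1) (H' s hs) (norm_nonneg _) hC
  have e0 := single_dotProduct_self 0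
  have e2 := single_dotProduct_self 2
  have e20 : (Pi.single 2 1 : Fin 3 → ℝ) ⬝ᵥ Pi.single 0 1 = 0 := by simp
  obtain ⟨C0, hC0, H0⟩ := (h.group _ e0).exists_bound hK
  obtain ⟨C2, hC2, H2⟩ := (h.group _ e2).exists_bound hK
  refine ⟨C2 * C0 * C2 * C2 * (C2 * C0 * C2), by positivity, fun a ha s hs => ?_⟩
  obtain ⟨r, hr, θ, hθ, rfl⟩ := exists_spherical ha
  refine conj_bound (perpRot_dotProduct_self e2 e0 e20 r) e2 ?_ (by positivity) hC2
    (conj_bound e2 e0 e20 hC2 hC0 H2 H0 r hr) H2 θ hθ s hs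
  rw [dotProduct_comm, dotProduct_perpRot e20]

/-- A discrete maximum principle: a positive Casimir scalar makes the average of neighbouring
translates of `x` exceed `x` at second order, which a bounded family stable under translation cannot
sustain. -/
theorem not_nontrivial [Nontrivial 𝓗] (h : IsSphereRep ι U T Φ) : False := by
  obtain ⟨F, hF⟩ : ∃ F, ι F ≠ 0 := by
    by_contra! H
    obtain ⟨x, hx⟩ := exists_ne (0 : 𝓗)
    have := (h.dense.equalizer continuous_id continuous_const (funext fun F => H F) :
      id = fun _ : 𝓗 => (0 : 𝓗))
    exact hx (congrFun this x)
  set x := ι F with hx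
  obtain ⟨C, hC, HC⟩ := h.exists_bound
  have hp := Real.pi_pos
  have hbd : ∀ a b, a ⬝ᵥ a = 1 → b ⬝ᵥ b = 1 → ‖quot U a b‖ ≤ C * C := fun a b ha hb =>
    (norm_mul_le _ _).trans (mul_le_mul (HC a ha _ ⟨by linarith, by linarith⟩)
      (HC b hb _ ⟨by linarith, by linarith⟩) (norm_nonneg _) hC)
  set 𝒮 : Set ℝ := {r | ∃ a b, a ⬝ᵥ a = 1 ∧ b ⬝ᵥ b = 1 ∧ r = ‖quot U a b x‖} with h𝒮
  have hbdd : BddAbove 𝒮 := by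
    refine ⟨C * C * ‖x‖, ?_⟩
    rintro _ ⟨a, b, ha, hb, rfl⟩
    exact (ContinuousLinearMap.le_opNorm _ _).trans
      (mul_le_mul_of_nonneg_right (hbd a b ha hb) (norm_nonneg _))
  have hmem : ‖x‖ ∈ 𝒮 := by
    have e0 := single_dotProduct_self 0
    refine ⟨_, _, e0, e0, ?_⟩
    rw [quot, (h.group _ e0).mul_neg]; rfl
  have hS : 0 < sSup 𝒮 := (norm_pos_iff.2 hF).trans_le (le_csSup hbdd hmem)
  -- With this tolerance the remainder, enlarged by at most `C * C` under a quotient, stays below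
  -- `sSup 𝒮 * t ^ 2`, less than the gain `3 * t ^ 2 * sSup 𝒮`.
  have hc : 0 < sSup 𝒮 / (C * C + 1) := by positivity
  obtain ⟨t, ht, ht0⟩ := (((Asymptotics.isLittleO_iff.1 (h.symm_sum_isLittleO F) hc).filter_mono
    (nhdsWithin_le_nhds (s := {0}ᶜ))).and self_mem_nhdsWithin).exists
  have ht2 : 0 < t ^ 2 := by have : t ≠ 0 := ht0; positivity
  rw [Real.norm_of_nonneg ht2.le] at ht
  set R := ∑ i : Fin 3, (U (Pi.single i 1) t x + U (Pi.single i 1) (-t) x) -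
      (6 + 3 * t ^ 2) • x with hR
  have key : ∀ r ∈ 𝒮, (6 + 3 * t ^ 2) * r ≤
      6 * sSup 𝒮 + C * C * (sSup 𝒮 / (C * C + 1) * t ^ 2) := by
    rintro _ ⟨a, b, ha, hb, rfl⟩
    have hu : ∀ (i : Fin 3) (s : ℝ), ‖quot U a b (U (Pi.single i 1) s x)‖ ≤ sSup 𝒮 := by
      intro i s
      obtain ⟨a', b', ha', hb', e⟩ := h.exists_quot_mul ha hb (single_dotProduct_self i) s
      refine le_csSup hbdd ⟨a', b', ha', hb', ?_⟩
      rw [← e]; rfl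
    have e : (6 + 3 * t ^ 2) • quot U a b x =
        ∑ i : Fin 3, (quot U a b (U (Pi.single i 1) t x) + quot U a b (U (Pi.single i 1) (-t) x)) -
          quot U a b R := by
      rw [hR, map_sub, map_sum]
      simp only [map_add]
      rw [sub_sub_cancel, ← ContinuousLinearMap.coe_restrictScalars' (R := ℝ), map_smul]
    calc (6 + 3 * t ^ 2) * ‖quot U a b x‖ = ‖(6 + 3 * t ^ 2) • quot U a b x‖ := by
          rw [norm_smul, Real.norm_of_nonneg (by positivity)]
      _ ≤ ∑ i : Fin 3, (sSup 𝒮 + sSup 𝒮) + C * C * (sSup 𝒮 / (C * C + 1) * t ^ 2) := by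
          rw [e]
          refine (norm_sub_le _ _).trans (add_le_add ?_ ?_)
          · exact norm_sum_le_of_le _ fun i _ => (norm_add_le _ _).trans
              (add_le_add (hu i t) (hu i (-t)))
          · exact (ContinuousLinearMap.le_opNorm _ _).trans
              (mul_le_mul (hbd a b ha hb) ht (norm_nonneg _) (by positivity))
      _ = _ := by simp; ring
  have h6 : 0 < 6 + 3 * t ^ 2 := by positivity
  have hle : sSup 𝒮 ≤ (6 * sSup 𝒮 + C * C * (sSup 𝒮 / (C * C + 1) * t ^ 2)) / (6 + 3 * t ^ 2) :=
    csSup_le ⟨_, hmem⟩ fun r hr => (le_div_iff₀' h6).2 (key r hr)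
  rw [le_div_iff₀ h6] at hle
  have hfrac : C * C * (sSup 𝒮 / (C * C + 1)) ≤ sSup 𝒮 := by
    rw [mul_div_assoc', div_le_iff₀ (by positivity)]
    nlinarith
  nlinarith [mul_le_mul_of_nonneg_right hfrac ht2.le, mul_pos hS ht2]

end IsSphereRep

/-! ### Star multiplication as operators on analytic functions -/

/-- The real analytic functions of time and phase space. -/
def analyticFun (m : ℕ) : Submodule ℂ (ℝ × PhaseSpace m → ℂ) where
  carrier := {G | AnalyticOnNhd ℝ G Set.univ}
  add_mem' h1 h2 := h1.add h2
  zero_mem' := analyticOnNhd_const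
  smul_mem' _ _ h := analyticOnNhd_const.mul h

namespace analyticFun

variable {m : ℕ}

theorem analytic (G : analyticFun m) : AnalyticOnNhd ℝ G.1 Set.univ := G.2

theorem contDiff (G : analyticFun m) {n : WithTop ℕ∞} : ContDiff ℝ n G.1 :=
  contDiffOn_univ.1 ((analytic G).contDiffOn uniqueDiffOn_univ)

theorem differentiableAt (G : analyticFun m) (z : ℝ × PhaseSpace m) :
    DifferentiableAt ℝ G.1 z := (G.2 z (Set.mem_univ z)).differentiableAt

@[ext] theorem ext {G G' : analyticFun m} (h : ∀ z, G.1 z = G'.1 z) : G = G' :=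
  Subtype.ext (funext h)

/-- The derivative in the direction `v`. -/
noncomputable def dir (v : ℝ × PhaseSpace m) : Module.End ℂ (analyticFun m) where
  toFun G := ⟨fun z => fderiv ℝ G.1 z v, fun z hz =>
    (ContinuousLinearMap.apply ℝ ℂ v).analyticAt _ |>.comp ((analytic G).fderiv z hz)⟩
  map_add' G G' := ext fun z => by
    simp [fderiv_add (differentiableAt G z) (differentiableAt G' z)]
  map_smul' c G := ext fun z => by
    simp [fderiv_const_smul (differentiableAt G z)]

/-- Multiplication by a coordinate of phase space. -/
noncomputable def coordMul (i : Fin m ⊕ Fin m) : Module.End ℂ (analyticFun m) where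
  toFun G := ⟨fun z => z.2 i * G.1 z, fun z hz => by
    refine AnalyticAt.mul ?_ (analytic G z hz)
    exact ((ContinuousLinearMap.proj i).comp
      (ContinuousLinearMap.snd ℝ ℝ (PhaseSpace m))).analyticAt z⟩
  map_add' G G' := ext fun z => by simp [mul_add]
  map_smul' c G := ext fun z => by simp [mul_left_comm]

@[simp] theorem dir_apply (v : ℝ × PhaseSpace m) (G : analyticFun m) (z : ℝ × PhaseSpace m) :
    (dir v G).1 z = fderiv ℝ G.1 z v := rfl

@[simp] theorem coordMul_apply (i : Fin m ⊕ Fin m) (G : analyticFun m) (z : ℝ × PhaseSpace m) :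
    (coordMul i G).1 z = z.2 i * G.1 z := rfl

theorem dir_dir_apply (v w : ℝ × PhaseSpace m) (G : analyticFun m) (z : ℝ × PhaseSpace m) :
    (dir v (dir w G)).1 z = fderiv ℝ (fderiv ℝ G.1) z v w := by
  have h : DifferentiableAt ℝ (fderiv ℝ G.1) z :=
    ((analytic G).fderiv z (Set.mem_univ z)).differentiableAt
  have := fderiv_clm_apply h (differentiableAt_const w)
  rw [dir_apply]
  change fderiv ℝ (fun z => fderiv ℝ G.1 z w) z v = _
  rw [this]
  simp

theorem dir_mul_comm (v w : ℝ × PhaseSpace m) : dir v * dir w = dir w * dir v := by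
  refine LinearMap.ext fun G => ext fun z => ?_
  rw [Module.End.mul_apply, Module.End.mul_apply, dir_dir_apply, dir_dir_apply]
  exact ((contDiff G (n := ⊤)).contDiffAt.isSymmSndFDerivAt (by simp)).eq v w

theorem coordMul_mul_comm (i j : Fin m ⊕ Fin m) :
    coordMul i * coordMul j = coordMul j * coordMul i := by
  refine LinearMap.ext fun G => ext fun z => ?_
  simp [mul_left_comm]

theorem dir_mul_coordMul (v : ℝ × PhaseSpace m) (i : Fin m ⊕ Fin m) :
    dir v * coordMul i = coordMul i * dir v + v.2 i • 1 := by
  refine LinearMap.ext fun G => ext fun z => ?_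
  have h1 : HasFDerivAt (fun z : ℝ × PhaseSpace m => z.2 i) ((ContinuousLinearMap.proj i).comp
      (ContinuousLinearMap.snd ℝ ℝ (PhaseSpace m))) z :=
    ((ContinuousLinearMap.proj i).comp
      (ContinuousLinearMap.snd ℝ ℝ (PhaseSpace m))).hasFDerivAt
  have h2 := (h1.mul (differentiableAt G z).hasFDerivAt).fderiv
  rw [Module.End.mul_apply, dir_apply]
  change fderiv ℝ ((fun z : ℝ × PhaseSpace m => z.2 i) * G.1) z v = _
  rw [h2]
  simp [mul_comm]

variable (ħ : ℝ) (K : Matrix (Fin m ⊕ Fin m) (Fin m ⊕ Fin m) ℂ)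

/-- The differential part of left star multiplication by the coordinate `i`. -/
noncomputable def contrDeriv (i : Fin m ⊕ Fin m) : Module.End ℂ (analyticFun m) :=
  (Complex.I * ħ / 2) • ∑ j, (K + Matrix.J (Fin m) ℂ) i j • dir (0, Pi.single j 1)

/-- Left star multiplication by the coordinate `i`. -/
noncomputable def starGen (i : Fin m ⊕ Fin m) : Module.End ℂ (analyticFun m) :=
  coordMul i + contrDeriv ħ K i

theorem contrDeriv_mul_coordMul (i j : Fin m ⊕ Fin m) :
    contrDeriv ħ K i * coordMul j = coordMul j * contrDeriv ħ K i +
      (Complex.I * ħ / 2 * (K + Matrix.J (Fin m) ℂ) i j) • 1 := by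
  simp only [contrDeriv, smul_mul_assoc, mul_smul_comm, Finset.sum_mul, Finset.mul_sum,
    dir_mul_coordMul, smul_add, Finset.sum_add_distrib]
  congr 1
  rw [mul_smul]
  congr 1
  simp [Pi.single_apply]

theorem dir_mul_contrDeriv (v : ℝ × PhaseSpace m) (i : Fin m ⊕ Fin m) :
    dir v * contrDeriv ħ K i = contrDeriv ħ K i * dir v := by
  simp only [contrDeriv, smul_mul_assoc, mul_smul_comm, Finset.sum_mul, Finset.mul_sum,
    dir_mul_comm v]

theorem contrDeriv_mul_comm (i j : Fin m ⊕ Fin m) :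
    contrDeriv ħ K i * contrDeriv ħ K j = contrDeriv ħ K j * contrDeriv ħ K i := by
  conv_lhs => rw [contrDeriv]
  conv_rhs => enter [2]; rw [contrDeriv]
  simp only [smul_mul_assoc, mul_smul_comm, Finset.sum_mul, Finset.mul_sum, dir_mul_contrDeriv]

theorem dir_time_mul_starGen (i : Fin m ⊕ Fin m) :
    dir (1, 0) * starGen ħ K i = starGen ħ K i * dir (1, 0) := by
  simp [starGen, mul_add, add_mul, dir_mul_contrDeriv, dir_mul_coordMul]

/-- The symmetric part `K` of `Λ` cancels in the commutator, leaving the entries of `J`. -/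
theorem starGen_comm (hK : K.IsSymm) (k : Fin m) :
    starGen ħ K (Sum.inr k) * starGen ħ K (Sum.inl k) =
      starGen ħ K (Sum.inl k) * starGen ħ K (Sum.inr k) + (Complex.I * ħ) • 1 := by
  have hs : K (Sum.inr k) (Sum.inl k) = K (Sum.inl k) (Sum.inr k) := hK.apply _ _
  simp only [starGen, mul_add, add_mul, contrDeriv_mul_coordMul,
    contrDeriv_mul_comm ħ K (Sum.inr k), coordMul_mul_comm (Sum.inr k), Matrix.add_apply, hs,
    Matrix.J, Matrix.fromBlocks_apply₁₂, Matrix.fromBlocks_apply₂₁, Matrix.neg_apply,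
    Matrix.one_apply_eq]
  module

end analyticFun

/-! ### Quadratic elements of the Weyl algebra -/

section Weyl

variable {R : Type*} [Semiring R] [Algebra ℂ R]

/-- The quadratic element `a u² + b v² + c (u v + v u)`. -/
def weylQuad (u v : R) (a b c : ℂ) : R :=
  a • (u * u) + b • (v * v) + c • (u * v + v * u)

theorem weylQuad_comm {u v : R} {κ : ℂ} (h : v * u = u * v + κ • 1) (a b c a' b' c' : ℂ) :
    weylQuad u v a b c * weylQuad u v a' b' c' =
      weylQuad u v a' b' c' * weylQuad u v a b c + κ • weylQuad u v (4 * (c * a' - a * c'))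
        (4 * (b * c' - c * b')) (-2 * (a * b' - b * a')) := by
  have h' : ∀ x, v * (u * x) = u * (v * x) + κ • x := fun x => by
    rw [← mul_assoc, h, add_mul, mul_assoc, smul_mul_assoc, one_mul]
  simp only [weylQuad, mul_add, add_mul, smul_add, smul_mul_assoc, mul_smul_comm, mul_assoc, h, h',
    mul_one, one_mul]
  module

/-- For commuting `u, v` the left side is `(u² + v²)² - (u² - v²)² - (2uv)² = 0`; normal ordering
shows that the commutators contribute just a scalar. -/
theorem weylQuad_casimir {u v : R} {κ : ℂ} (h : v * u = u * v + κ • 1) :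
    weylQuad u v 1 1 0 * weylQuad u v 1 1 0 +
      weylQuad u v Complex.I (-Complex.I) 0 * weylQuad u v Complex.I (-Complex.I) 0 +
      weylQuad u v 0 0 Complex.I * weylQuad u v 0 0 Complex.I = (3 * κ ^ 2) • 1 := by
  have h' : ∀ x, v * (u * x) = u * (v * x) + κ • x := fun x => by
    rw [← mul_assoc, h, add_mul, mul_assoc, smul_mul_assoc, one_mul]
  simp only [weylQuad, mul_add, add_mul, smul_add, smul_mul_assoc, mul_smul_comm, mul_assoc, h, h',
    mul_one, one_mul, smul_smul]
  match_scalars <;> ring_nf <;> simp only [Complex.I_sq] <;> ring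

end Weyl

/-! ### The star product with a quadratic polynomial -/

section starMul

variable {m : ℕ}

theorem starMul_of_iterPartial_eq_zero (ħ : ℝ) (K : Matrix (Fin m ⊕ Fin m) (Fin m ⊕ Fin m) ℂ)
    (H F : PhaseSpace m → ℂ) (u : PhaseSpace m)
    (hH : ∀ n (s : Fin (n + 3) → Fin m ⊕ Fin m), iterPartial s H u = 0) :
    starMul ħ K H F u = H u * F u +
      Complex.I * ħ / 2 * ∑ i, ∑ j, (K + Matrix.J (Fin m) ℂ) i j *
        fderiv ℂ H u (Pi.single i 1) * fderiv ℂ F u (Pi.single j 1) +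
      (Complex.I * ħ) ^ 2 / 8 * ∑ i, ∑ i', ∑ j, ∑ j',
        (K + Matrix.J (Fin m) ℂ) i j * (K + Matrix.J (Fin m) ℂ) i' j' *
          fderiv ℂ (fderiv ℂ H) u (Pi.single i 1) (Pi.single i' 1) *
          fderiv ℂ (fderiv ℂ F) u (Pi.single j 1) (Pi.single j' 1) := by
  have sum1 : ∀ f : (Fin 1 → Fin m ⊕ Fin m) → ℂ, ∑ s, f s = ∑ i, f (fun _ => i) := fun f =>
    (Fintype.sum_equiv (Equiv.funUnique (Fin 1) (Fin m ⊕ Fin m)).symm _ _ fun i => rfl).symm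
  have sum2 : ∀ f : (Fin 2 → Fin m ⊕ Fin m) → ℂ, ∑ s, f s = ∑ i, ∑ j, f ![i, j] := fun f => by
    rw [← Fintype.sum_prod_type']
    exact (Fintype.sum_equiv (finTwoArrowEquiv (Fin m ⊕ Fin m)).symm _ _ fun i => rfl).symm
  rw [starMul, tsum_eq_sum (s := Finset.range 3)]
  · simp only [Finset.sum_range_succ, Finset.sum_range_zero, sum1, sum2, iterPartial,
      iteratedFDeriv_one_apply, iteratedFDeriv_two_apply, iteratedFDeriv_zero_apply]
    simp
    norm_num [Nat.factorial]
  · intro n hn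
    obtain ⟨n, rfl⟩ : ∃ k, n = k + 3 := ⟨n - 3, by simp at hn; omega⟩
    simp [hH]

/-- A quadratic function in two coordinates. -/
def quadFun (p q : Fin m ⊕ Fin m) (a b c d : ℂ) : PhaseSpace m → ℂ :=
  fun u => a * (u p * u p) + b * (u q * u q) + 2 * c * (u p * u q) + d

/-- The polarization of the quadratic form `2 (a x² + b y² + 2 c x y)`. -/
noncomputable def polarForm {E : Type*} [NormedAddCommGroup E] [NormedSpace ℂ E] (x y : E →L[ℂ] ℂ)
    (a b c : ℂ) : E →L[ℂ] E →L[ℂ] ℂ :=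
  (2 : ℂ) • (a • x.smulRight x + b • y.smulRight y + c • (x.smulRight y + y.smulRight x))

theorem polarForm_apply {E : Type*} [NormedAddCommGroup E] [NormedSpace ℂ E] (x y : E →L[ℂ] ℂ)
    (a b c : ℂ) (u w : E) : polarForm x y a b c u w =
      2 * (a * (x u * x w) + b * (y u * y w) + c * (x u * y w + y u * x w)) := by
  rfl

/-- The differential of `quadFun`. -/
noncomputable def quadFunDeriv (p q : Fin m ⊕ Fin m) (a b c : ℂ) :
    PhaseSpace m →L[ℂ] PhaseSpace m →L[ℂ] ℂ :=
  polarForm (ContinuousLinearMap.proj p) (ContinuousLinearMap.proj q) a b c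

theorem quadFunDeriv_apply (p q : Fin m ⊕ Fin m) (a b c : ℂ) (u w : PhaseSpace m) :
    quadFunDeriv p q a b c u w =
      2 * (a * (u p * w p) + b * (u q * w q) + c * (u p * w q + u q * w p)) :=
  polarForm_apply _ _ a b c u w

theorem hasFDerivAt_quadFun (p q : Fin m ⊕ Fin m) (a b c d : ℂ) (u : PhaseSpace m) :
    HasFDerivAt (quadFun p q a b c d) (quadFunDeriv p q a b c u) u := by
  have h : ∀ i, HasFDerivAt (fun u : PhaseSpace m => u i)
      (ContinuousLinearMap.proj i : PhaseSpace m →L[ℂ] ℂ) u := fun i =>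
    (ContinuousLinearMap.proj i : PhaseSpace m →L[ℂ] ℂ).hasFDerivAt
  have := (((((h p).mul (h p)).const_mul a).add (((h q).mul (h q)).const_mul b)).add
    (((h p).mul (h q)).const_mul (2 * c))).add_const d
  refine this.congr_fderiv ?_
  ext w
  simp [quadFunDeriv_apply]
  ring

theorem fderiv_quadFun (p q : Fin m ⊕ Fin m) (a b c d : ℂ) :
    fderiv ℂ (quadFun p q a b c d) = quadFunDeriv p q a b c :=
  funext fun u => (hasFDerivAt_quadFun p q a b c d u).fderiv

theorem iterPartial_quadFun (p q : Fin m ⊕ Fin m) (a b c d : ℂ) (n : ℕ)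
    (s : Fin (n + 3) → Fin m ⊕ Fin m) (u : PhaseSpace m) :
    iterPartial s (quadFun p q a b c d) u = 0 := by
  have h1 : (fderiv ℂ fun y => fderiv ℂ (quadFun p q a b c d) y) =
      fun _ => quadFunDeriv p q a b c := by
    funext u
    rw [fderiv_quadFun]
    exact (quadFunDeriv p q a b c).fderiv
  rw [iterPartial, iteratedFDeriv_succ_apply_right, iteratedFDeriv_succ_apply_right, h1,
    iteratedFDeriv_succ_const]
  simp

theorem starMul_quadFun (ħ : ℝ) (K : Matrix (Fin m ⊕ Fin m) (Fin m ⊕ Fin m) ℂ)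
    (p q : Fin m ⊕ Fin m) (a b c d : ℂ) (F : PhaseSpace m → ℂ) (u : PhaseSpace m) :
    starMul ħ K (quadFun p q a b c d) F u = quadFun p q a b c d u * F u +
      Complex.I * ħ * ∑ j, ((a * u p + c * u q) * (K + Matrix.J (Fin m) ℂ) p j +
        (b * u q + c * u p) * (K + Matrix.J (Fin m) ℂ) q j) * fderiv ℂ F u (Pi.single j 1) +
      (Complex.I * ħ) ^ 2 / 4 * ∑ j, ∑ j',
        (a * ((K + Matrix.J (Fin m) ℂ) p j * (K + Matrix.J (Fin m) ℂ) p j') +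
          b * ((K + Matrix.J (Fin m) ℂ) q j * (K + Matrix.J (Fin m) ℂ) q j') +
          c * ((K + Matrix.J (Fin m) ℂ) p j * (K + Matrix.J (Fin m) ℂ) q j' +
            (K + Matrix.J (Fin m) ℂ) q j * (K + Matrix.J (Fin m) ℂ) p j')) *
          fderiv ℂ (fderiv ℂ F) u (Pi.single j 1) (Pi.single j' 1) := by
  set Λ := K + Matrix.J (Fin m) ℂ
  have e : ∀ i, fderiv ℂ (quadFunDeriv p q a b c) i = quadFunDeriv p q a b c := fun i =>
    (quadFunDeriv p q a b c).fderiv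
  rw [starMul_of_iterPartial_eq_zero ħ K _ F u fun n s => iterPartial_quadFun p q a b c d n s u]
  simp only [fderiv_quadFun, e, quadFunDeriv_apply]
  congr 1
  · congr 1
    rw [Finset.sum_comm, Finset.mul_sum, Finset.mul_sum]
    refine Finset.sum_congr rfl fun j _ => ?_
    have : ∀ i, Λ i j * (2 * (a * (u p * (Pi.single i 1 : PhaseSpace m) p) +
        b * (u q * (Pi.single i 1 : PhaseSpace m) q) +
        c * (u p * (Pi.single i 1 : PhaseSpace m) q + u q * (Pi.single i 1 : PhaseSpace m) p))) *
        fderiv ℂ F u (Pi.single j 1) =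
        (if p = i then 2 * (a * u p + c * u q) * Λ i j * fderiv ℂ F u (Pi.single j 1) else 0) +
        (if q = i then 2 * (b * u q + c * u p) * Λ i j * fderiv ℂ F u (Pi.single j 1) else 0) := by
      intro i
      simp only [Pi.single_apply]
      split_ifs <;> ring
    change _ * ∑ i, Λ i j * _ * _ = _
    rw [Finset.sum_congr rfl fun i _ => this i, Finset.sum_add_distrib, Finset.sum_ite_eq,
      Finset.sum_ite_eq, if_pos (Finset.mem_univ _), if_pos (Finset.mem_univ _)]
    ring
  · set Y : Fin m ⊕ Fin m → Fin m ⊕ Fin m → ℂ := fun j j' =>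
      fderiv ℂ (fderiv ℂ F) u (Pi.single j 1) (Pi.single j' 1) with hY
    set g : Fin m ⊕ Fin m → Fin m ⊕ Fin m → ℂ := fun i i' =>
      ∑ j, ∑ j', Λ i j * Λ i' j' * Y j j' with hg
    have h1 : ∀ i i', ∑ j, ∑ j', Λ i j * Λ i' j' * (2 * (a * ((Pi.single i 1 : PhaseSpace m) p *
        (Pi.single i' 1 : PhaseSpace m) p) + b * ((Pi.single i 1 : PhaseSpace m) q *
        (Pi.single i' 1 : PhaseSpace m) q) + c * ((Pi.single i 1 : PhaseSpace m) p *
        (Pi.single i' 1 : PhaseSpace m) q + (Pi.single i 1 : PhaseSpace m) q *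
        (Pi.single i' 1 : PhaseSpace m) p))) * Y j j' =
        (if p = i then (if p = i' then 2 * a * g i i' else 0) else 0) +
        (if q = i then (if q = i' then 2 * b * g i i' else 0) else 0) +
        (if p = i then (if q = i' then 2 * c * g i i' else 0) else 0) +
        (if q = i then (if p = i' then 2 * c * g i i' else 0) else 0) := by
      intro i i'
      simp only [Pi.single_apply, hg, Finset.mul_sum]
      split_ifs <;> simp only [← Finset.sum_add_distrib, add_zero, zero_add] <;>
        first
        | exact Finset.sum_congr rfl fun j _ => Finset.sum_congr rfl fun j' _ => by ring
        | simp
    have h2 : ∀ (x y : Fin m ⊕ Fin m) (f : Fin m ⊕ Fin m → Fin m ⊕ Fin m → ℂ),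
        ∑ i, ∑ i', (if x = i then (if y = i' then f i i' else 0) else 0) = f x y := fun x y f => by
      rw [Finset.sum_eq_single x (fun i _ hi => by simp [hi.symm]) (by simp)]
      simp
    rw [Finset.sum_congr rfl fun i _ => Finset.sum_congr rfl fun i' _ => h1 i i']
    simp only [Finset.sum_add_distrib, h2, hg, add_mul, mul_add, Finset.mul_sum]
    simp only [← Finset.sum_add_distrib]
    exact Finset.sum_congr rfl fun j _ => Finset.sum_congr rfl fun j' _ => by ring

end starMul

/-! ### Complex derivatives of time slices -/

section slice

variable {m : ℕ}

/-- Real second-order smoothness is already available, so only complex linearity of the derivative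
needs proof. Symmetry of the real second differential transfers it from the complex-linear first
differential of `F`. -/
theorem differentiable_fderiv_apply {F : PhaseSpace m → ℂ} (hF : Differentiable ℂ F)
    (hF2 : ContDiff ℝ 2 F) (w : PhaseSpace m) :
    Differentiable ℂ (fun u => fderiv ℂ F u w) := by
  have hre : ∀ u v, fderiv ℂ F u v = fderiv ℝ F u v := fun u v => by
    rw [(hF u).fderiv_restrictScalars ℝ]; rfl
  have hd : Differentiable ℝ (fderiv ℝ F) :=
    (hF2.fderiv_right (m := 1) (by norm_num)).differentiable (by norm_num)
  have h2 : ∀ u v v', fderiv ℝ (fun y => fderiv ℝ F y v) u v' =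
      fderiv ℝ (fderiv ℝ F) u v v' := fun u v v' => by
    rw [fderiv_clm_apply (hd u) (differentiableAt_const v)]
    simp only [fderiv_fun_const, Pi.zero_apply, ContinuousLinearMap.comp_zero, zero_add,
      ContinuousLinearMap.flip_apply]
    exact (hF2.contDiffAt.isSymmSndFDerivAt (by simp)).eq v' v
  intro u
  simp only [hre]
  have hg : DifferentiableAt ℝ (fun y => fderiv ℝ F y w) u :=
    (hd u).clm_apply (differentiableAt_const w)
  refine (differentiableAt_iff_restrictScalars ℝ hg).2 ?_
  refine ⟨⟨⟨⟨fun v => fderiv ℝ (fun y => fderiv ℝ F y w) u v, fun x y => map_add _ x y⟩,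
    fun c v => ?_⟩, (fderiv ℝ (fun y => fderiv ℝ F y w) u).continuous⟩, rfl⟩
  have hc : (fun y => fderiv ℝ F y (c • v)) = fun y => c • fderiv ℝ F y v := by
    funext y
    rw [← hre, map_smul, hre]
  have hv : DifferentiableAt ℝ (fun y => fderiv ℝ F y v) u :=
    (hd u).clm_apply (differentiableAt_const v)
  have sym : ∀ a b, fderiv ℝ (fderiv ℝ F) u a b = fderiv ℝ (fderiv ℝ F) u b a :=
    (hF2.contDiffAt.isSymmSndFDerivAt (by simp)).eq
  change fderiv ℝ (fun y => fderiv ℝ F y w) u (c • v) =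
    c • fderiv ℝ (fun y => fderiv ℝ F y w) u v
  rw [h2, sym, ← h2, hc, fderiv_fun_const_smul hv, h2, sym, ← h2]
  rfl

theorem differentiable_fderiv {F : PhaseSpace m → ℂ} (hF : Differentiable ℂ F)
    (hF2 : ContDiff ℝ 2 F) : Differentiable ℂ (fderiv ℂ F) := by
  have : fderiv ℂ F = fun u => ∑ j, fderiv ℂ F u (Pi.single j 1) •
      (ContinuousLinearMap.proj j : PhaseSpace m →L[ℂ] ℂ) := by
    funext u
    refine ContinuousLinearMap.ext fun w => ?_
    conv_lhs => rw [← Finset.univ_sum_single w, map_sum]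
    rw [_root_.sum_apply]
    refine Finset.sum_congr rfl fun j _ => ?_
    have : (Pi.single j (w j) : PhaseSpace m) = w j • Pi.single j 1 := by
      rw [← Pi.single_smul, smul_eq_mul, mul_one]
    rw [this, map_smul]
    simp [mul_comm]
  rw [this]
  exact Differentiable.fun_sum fun j _ =>
    (differentiable_fderiv_apply hF hF2 _).smul_const _

namespace analyticFun

variable (G : analyticFun m) (t : ℝ)

theorem contDiff_slice {n : WithTop ℕ∞} : ContDiff ℝ n (fun u => G.1 (t, u)) :=
  (contDiff G).comp (contDiff_const.prodMk contDiff_id)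

theorem fderiv_slice (h : Differentiable ℂ fun u => G.1 (t, u)) (u e : PhaseSpace m) :
    fderiv ℂ (fun u => G.1 (t, u)) u e = (dir (0, e) G).1 (t, u) := by
  have h1 : fderiv ℂ (fun u => G.1 (t, u)) u e = fderiv ℝ (fun u => G.1 (t, u)) u e := by
    rw [(h u).fderiv_restrictScalars ℝ]; rfl
  have h2 : HasFDerivAt (fun u : PhaseSpace m => (t, u))
      (ContinuousLinearMap.inr ℝ ℝ (PhaseSpace m)) u := hasFDerivAt_prodMk_right t u
  have h3 : HasFDerivAt (fun u => G.1 (t, u)) _ u :=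
    (differentiableAt G (t, u)).hasFDerivAt.comp u h2
  rw [h1, h3.fderiv]
  simp

theorem differentiable_slice_dir (h : Differentiable ℂ fun u => G.1 (t, u)) (e : PhaseSpace m) :
    Differentiable ℂ fun u => (dir (0, e) G).1 (t, u) := by
  simp only [← fderiv_slice G t h]
  exact differentiable_fderiv_apply h (contDiff_slice G t) e

theorem fderiv_fderiv_slice (h : Differentiable ℂ fun u => G.1 (t, u)) (u e e' : PhaseSpace m) :
    fderiv ℂ (fderiv ℂ fun u => G.1 (t, u)) u e e' =
      (dir (0, e) (dir (0, e') G)).1 (t, u) := by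
  rw [← fderiv_slice _ t (differentiable_slice_dir G t h e')]
  simp only [← fderiv_slice G t h]
  rw [fderiv_clm_apply (differentiable_fderiv h (contDiff_slice G t) u)
    (differentiableAt_const e')]
  simp

end analyticFun

end slice

/-! ### Identification of the star product with the operators -/

section bridge

variable {m : ℕ} (ħ : ℝ) (K : Matrix (Fin m ⊕ Fin m) (Fin m ⊕ Fin m) ℂ)

theorem starMul_coord (p q : Fin m ⊕ Fin m) (u : PhaseSpace m) :
    starMul ħ K (fun u => u p) (fun u => u q) u =
      u p * u q + Complex.I * ħ / 2 * (K + Matrix.J (Fin m) ℂ) p q := by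
  have hd : ∀ q : Fin m ⊕ Fin m, fderiv ℂ (fun u : PhaseSpace m => u q) =
      fun _ => ContinuousLinearMap.proj q := fun q => funext fun u =>
    (ContinuousLinearMap.proj q : PhaseSpace m →L[ℂ] ℂ).fderiv
  rw [starMul_of_iterPartial_eq_zero]
  · rw [hd, hd]
    simp [Pi.single_apply]
  · intro n s
    rw [iterPartial, iteratedFDeriv_succ_apply_right, hd, iteratedFDeriv_succ_const]
    simp

theorem quadForm_eq (k : Fin m) (a b c : ℂ) :
    quadForm ħ K k a b c = quadFun (Sum.inl k) (Sum.inr k) ((Complex.I * ħ)⁻¹ * a)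
      ((Complex.I * ħ)⁻¹ * b) ((Complex.I * ħ)⁻¹ * c) ((Complex.I * ħ)⁻¹ * (Complex.I * ħ / 2) *
        (a * (K + Matrix.J (Fin m) ℂ) (Sum.inl k) (Sum.inl k) +
          b * (K + Matrix.J (Fin m) ℂ) (Sum.inr k) (Sum.inr k) +
          c * ((K + Matrix.J (Fin m) ℂ) (Sum.inl k) (Sum.inr k) +
            (K + Matrix.J (Fin m) ℂ) (Sum.inr k) (Sum.inl k)))) := by
  funext u
  have h1 := starMul_coord ħ K (Sum.inl k) (Sum.inl k) u
  have h2 := starMul_coord ħ K (Sum.inr k) (Sum.inr k) u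
  have h3 := starMul_coord ħ K (Sum.inl k) (Sum.inr k) u
  have h4 := starMul_coord ħ K (Sum.inr k) (Sum.inl k) u
  rw [quadForm]
  unfold genU genV
  rw [h1, h2, h3, h4, quadFun]
  ring

namespace analyticFun

/-- Left star multiplication by `quadForm`. -/
noncomputable def starQuad (k : Fin m) (a b c : ℂ) : Module.End ℂ (analyticFun m) :=
  (Complex.I * ħ)⁻¹ • weylQuad (starGen ħ K (Sum.inl k)) (starGen ħ K (Sum.inr k)) a b c

theorem starGen_mul_starGen_apply (p q : Fin m ⊕ Fin m) (G : analyticFun m)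
    (z : ℝ × PhaseSpace m) :
    ((starGen ħ K p * starGen ħ K q) G).1 z =
      z.2 p * z.2 q * G.1 z + z.2 p * (contrDeriv ħ K q G).1 z + z.2 q * (contrDeriv ħ K p G).1 z +
      Complex.I * ħ / 2 * (K + Matrix.J (Fin m) ℂ) p q * G.1 z +
      (contrDeriv ħ K p (contrDeriv ħ K q G)).1 z := by
  have : starGen ħ K p * starGen ħ K q = coordMul p * coordMul q + coordMul p * contrDeriv ħ K q +
      (coordMul q * contrDeriv ħ K p + (Complex.I * ħ / 2 * (K + Matrix.J (Fin m) ℂ) p q) • 1) +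
      contrDeriv ħ K p * contrDeriv ħ K q := by
    rw [← contrDeriv_mul_coordMul]
    simp only [starGen, mul_add, add_mul]
    abel
  rw [this]
  simp only [LinearMap.add_apply, Module.End.mul_apply, LinearMap.smul_apply, Module.End.one_apply,
    Submodule.coe_add, Submodule.coe_smul, Pi.add_apply, Pi.smul_apply, coordMul_apply,
    smul_eq_mul]
  ring

theorem contrDeriv_eq (p : Fin m ⊕ Fin m) (G : analyticFun m) :
    contrDeriv ħ K p G = (Complex.I * ħ / 2) •
      ∑ j, (K + Matrix.J (Fin m) ℂ) p j • dir (0, Pi.single j 1) G := by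
  rw [contrDeriv, LinearMap.smul_apply, LinearMap.sum_apply]
  rfl

theorem coe_smul_sum (c : ℂ) (f : Fin m ⊕ Fin m → ℂ) (G : Fin m ⊕ Fin m → analyticFun m)
    (z : ℝ × PhaseSpace m) :
    (c • ∑ j, f j • G j : analyticFun m).1 z = c * ∑ j, f j * (G j).1 z := by
  rw [Submodule.coe_smul, Submodule.coe_sum, Pi.smul_apply, Finset.sum_apply]
  rfl

theorem contrDeriv_apply (p : Fin m ⊕ Fin m) (G : analyticFun m) (z : ℝ × PhaseSpace m) :
    (contrDeriv ħ K p G).1 z = Complex.I * ħ / 2 *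
      ∑ j, (K + Matrix.J (Fin m) ℂ) p j * (dir (0, Pi.single j 1) G).1 z := by
  rw [contrDeriv_eq, coe_smul_sum]

theorem contrDeriv_contrDeriv_apply (p q : Fin m ⊕ Fin m) (G : analyticFun m)
    (z : ℝ × PhaseSpace m) :
    (contrDeriv ħ K p (contrDeriv ħ K q G)).1 z = (Complex.I * ħ) ^ 2 / 4 *
      ∑ j, ∑ j', (K + Matrix.J (Fin m) ℂ) p j * (K + Matrix.J (Fin m) ℂ) q j' *
        (dir (0, Pi.single j 1) (dir (0, Pi.single j' 1) G)).1 z := by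
  rw [contrDeriv_apply, Finset.mul_sum, Finset.mul_sum]
  refine Finset.sum_congr rfl fun j _ => ?_
  rw [contrDeriv_eq, map_smul, map_sum]
  simp only [map_smul]
  rw [coe_smul_sum, Finset.mul_sum, Finset.mul_sum, Finset.mul_sum, Finset.mul_sum]
  exact Finset.sum_congr rfl fun j' _ => by ring

/-- This carries operator identities back to the series definition. Holomorphy of the slice is
needed because `dir` is a real derivative while the star product uses complex ones. -/
theorem starMul_quadForm (k : Fin m) (a b c : ℂ) (G : analyticFun m) (t : ℝ)
    (h : Differentiable ℂ fun u => G.1 (t, u)) (u : PhaseSpace m) :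
    starMul ħ K (quadForm ħ K k a b c) (fun u => G.1 (t, u)) u =
      (starQuad ħ K k a b c G).1 (t, u) := by
  rw [quadForm_eq, starMul_quadFun]
  simp only [fderiv_slice G t h, fderiv_fderiv_slice G t h]
  simp only [starQuad, weylQuad, LinearMap.smul_apply, LinearMap.add_apply, Submodule.coe_smul,
    Submodule.coe_add, Pi.smul_apply, Pi.add_apply, smul_eq_mul, starGen_mul_starGen_apply,
    contrDeriv_contrDeriv_apply, quadFun]
  simp only [contrDeriv_apply]
  set Λ := K + Matrix.J (Fin m) ℂ
  set κ : ℂ := Complex.I * ħ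
  have s1 : ∀ (α β : ℂ) (f g d : Fin m ⊕ Fin m → ℂ), ∑ j, (α * f j + β * g j) * d j =
      α * ∑ j, f j * d j + β * ∑ j, g j * d j := fun α β f g d => by
    simp only [Finset.mul_sum, ← Finset.sum_add_distrib]
    exact Finset.sum_congr rfl fun j _ => by ring
  have s2 : ∀ (α β γ : ℂ) (f g h h' d : Fin m ⊕ Fin m → Fin m ⊕ Fin m → ℂ),
      ∑ j, ∑ j', (α * f j j' + β * g j j' + γ * (h j j' + h' j j')) * d j j' =
      α * ∑ j, ∑ j', f j j' * d j j' + β * ∑ j, ∑ j', g j j' * d j j' +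
        γ * (∑ j, ∑ j', h j j' * d j j' + ∑ j, ∑ j', h' j j' * d j j') :=
      fun α β γ f g h h' d => by
    simp only [Finset.mul_sum, ← Finset.sum_add_distrib]
    exact Finset.sum_congr rfl fun j _ => Finset.sum_congr rfl fun j' _ => by ring
  rw [s1, s2 _ _ _ (fun j j' => Λ (Sum.inl k) j * Λ (Sum.inl k) j')
    (fun j j' => Λ (Sum.inr k) j * Λ (Sum.inr k) j')
    (fun j j' => Λ (Sum.inl k) j * Λ (Sum.inr k) j')
    (fun j j' => Λ (Sum.inr k) j * Λ (Sum.inl k) j')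
    (fun j j' => (dir (0, Pi.single j 1) (dir (0, Pi.single j' 1) G)).1 (t, u))]
  ring

end analyticFun

end bridge

/-! ### Uniqueness of the evolution by analyticity in time -/

theorem AnalyticAt.eventually_eq_zero_of_iteratedDeriv {f : ℝ → ℂ} {x : ℝ} (hf : AnalyticAt ℝ f x)
    (h : ∀ n, iteratedDeriv n f x = 0) : ∀ᶠ y in 𝓝 x, f y = 0 := by
  obtain ⟨p, r, hp⟩ := hf
  have hz : ∀ y n, p n (fun _ => y) = 0 := by
    intro y n
    have h1 := hp.factorial_smul y n
    have h2 : iteratedFDeriv ℝ n f x (fun _ => y) = 0 := by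
      have h3 : iteratedFDeriv ℝ n f x = 0 := by
        rw [iteratedFDeriv_eq_equiv_comp]
        simp [h]
      rw [h3]; rfl
    rw [h2] at h1
    exact (smul_eq_zero.1 h1).resolve_left n.factorial_ne_zero
  filter_upwards [Metric.eball_mem_nhds x hp.r_pos] with y hy
  have hs := hp.hasSum_sub hy
  simp only [hz] at hs
  exact hs.unique hasSum_zero

namespace analyticFun

variable {m : ℕ}

theorem deriv_time (G : analyticFun m) (t : ℝ) (u : PhaseSpace m) :
    HasDerivAt (fun t => G.1 (t, u)) ((dir (1, 0) G).1 (t, u)) t := by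
  have h2 : HasFDerivAt (fun t : ℝ => (t, u)) (ContinuousLinearMap.inl ℝ ℝ (PhaseSpace m)) t :=
    hasFDerivAt_prodMk_left t u
  have h3 : HasFDerivAt (fun t => G.1 (t, u)) _ t :=
    (differentiableAt G (t, u)).hasFDerivAt.comp t h2
  simpa using h3.hasDerivAt

theorem iteratedDeriv_time (G : analyticFun m) (n : ℕ) (u : PhaseSpace m) :
    iteratedDeriv n (fun t => G.1 (t, u)) = fun t => ((dir (1, 0) ^ n) G).1 (t, u) := by
  induction n with
  | zero => simp
  | succ n ih =>
    rw [iteratedDeriv_succ, ih]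
    funext t
    rw [(deriv_time _ t u).deriv, pow_succ']
    rfl

theorem eq_zero_of_dir_pow (G : analyticFun m)
    (h : ∀ n u, ((dir (1, 0) ^ n) G).1 (0, u) = 0) : G = 0 := by
  refine ext fun z => ?_
  obtain ⟨t, u⟩ := z
  have ha : AnalyticOnNhd ℝ (fun t => G.1 (t, u)) Set.univ := fun s _ =>
    AnalyticAt.comp (g := G.1) (f := fun t : ℝ => (t, u)) (analytic G (s, u) trivial)
      (AnalyticAt.prod analyticAt_id analyticAt_const)
  have h0 := (ha 0 trivial).eventually_eq_zero_of_iteratedDeriv fun n => by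
    rw [iteratedDeriv_time]; exact h n u
  exact ha.eqOn_zero_of_preconnected_of_eventuallyEq_zero isPreconnected_univ trivial h0
    (Set.mem_univ t)

section initial

variable {G : analyticFun m}

theorem dir_initial (h : ∀ u, G.1 (0, u) = 0) (e u : PhaseSpace m) :
    (dir (0, e) G).1 (0, u) = 0 := by
  have hd : Differentiable ℂ fun u => G.1 (0, u) := by simp [h]
  rw [← fderiv_slice G 0 hd]
  simp [h]

variable (ħ : ℝ) (K : Matrix (Fin m ⊕ Fin m) (Fin m ⊕ Fin m) ℂ)

theorem starGen_initial (h : ∀ u, G.1 (0, u) = 0) (i : Fin m ⊕ Fin m) (u : PhaseSpace m) :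
    (starGen ħ K i G).1 (0, u) = 0 := by
  rw [starGen, LinearMap.add_apply, Submodule.coe_add, Pi.add_apply, contrDeriv_apply]
  simp only [dir_initial h, coordMul_apply, h]
  simp

theorem starQuad_initial (h : ∀ u, G.1 (0, u) = 0) (k : Fin m) (a b c : ℂ) (u : PhaseSpace m) :
    (starQuad ħ K k a b c G).1 (0, u) = 0 := by
  simp only [starQuad, weylQuad, LinearMap.smul_apply, LinearMap.add_apply, Submodule.coe_smul,
    Submodule.coe_add, Pi.smul_apply, Pi.add_apply, smul_eq_mul, Module.End.mul_apply,
    starGen_initial ħ K (fun u => starGen_initial ħ K h _ u)]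
  simp

theorem dir_time_mul_starQuad (k : Fin m) (a b c : ℂ) :
    dir (1, 0) * starQuad ħ K k a b c = starQuad ħ K k a b c * dir (1, 0) := by
  have h : ∀ i j, dir (1, 0) * (starGen ħ K i * starGen ħ K j) =
      starGen ħ K i * starGen ħ K j * dir (1, 0) := fun i j => by
    rw [← mul_assoc, dir_time_mul_starGen, mul_assoc, dir_time_mul_starGen, mul_assoc]
  simp only [starQuad, weylQuad, mul_smul_comm, smul_mul_assoc, mul_add, add_mul, h]

/-- Uniqueness of the evolution generated by a quadratic form. -/
theorem eq_zero_of_evolution (k : Fin m) (a b c : ℂ) (h : ∀ u, G.1 (0, u) = 0)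
    (hev : dir (1, 0) G = starQuad ħ K k a b c G) : G = 0 := by
  refine eq_zero_of_dir_pow G fun n => ?_
  induction n with
  | zero => simpa using h
  | succ n ih =>
    -- Since the form does not depend on time, each further time derivative is the form applied to
    -- the previous one, and this preserves vanishing at time `0`.
    have hc : Commute (dir (1, 0) ^ n) (starQuad ħ K k a b c) :=
      Commute.pow_left (dir_time_mul_starQuad ħ K k a b c) n
    have : (dir (1, 0) ^ (n + 1)) G = starQuad ħ K k a b c ((dir (1, 0) ^ n) G) := by
      rw [pow_succ, Module.End.mul_apply, hev, ← Module.End.mul_apply, hc.eq]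
      rfl
    rw [this]
    exact starQuad_initial ħ K ih k a b c

end initial

/-! ### The sphere of quadratic forms and its rotation by the evolution -/

/-- Multiplication by a real analytic function of time. -/
noncomputable def mulTime (f : ℝ → ℝ) (hf : AnalyticOnNhd ℝ f Set.univ) :
    Module.End ℂ (analyticFun m) where
  toFun G := ⟨fun z => f z.1 * G.1 z, fun z hz => by
    refine AnalyticAt.mul ?_ (analytic G z hz)
    exact (Complex.ofRealCLM.analyticAt _).comp ((hf z.1 trivial).comp analyticAt_fst)⟩
  map_add' G G' := ext fun z => by simp [mul_add]
  map_smul' c G := ext fun z => by simp [mul_left_comm]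

@[simp] theorem mulTime_apply (f : ℝ → ℝ) (hf : AnalyticOnNhd ℝ f Set.univ) (G : analyticFun m)
    (z : ℝ × PhaseSpace m) : (mulTime f hf G).1 z = f z.1 * G.1 z := rfl

theorem dir_mul_mulTime {f f' : ℝ → ℝ} (hf : AnalyticOnNhd ℝ f Set.univ)
    (hf' : AnalyticOnNhd ℝ f' Set.univ) (h : ∀ t, HasDerivAt f (f' t) t) (v : ℝ × PhaseSpace m) :
    dir v * mulTime f hf = mulTime f hf * dir v + (v.1 : ℂ) • mulTime f' hf' := by
  refine LinearMap.ext fun G => ext fun z => ?_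
  have h0 : HasFDerivAt (fun z : ℝ × PhaseSpace m => z.1)
      (ContinuousLinearMap.fst ℝ ℝ (PhaseSpace m)) z := hasFDerivAt_fst
  have h1 : HasFDerivAt (fun z : ℝ × PhaseSpace m => (f z.1 : ℂ)) _ z :=
    (h z.1).ofReal_comp.hasFDerivAt.comp z h0
  have h2 := (h1.mul (differentiableAt G z).hasFDerivAt).fderiv
  rw [Module.End.mul_apply, dir_apply]
  change fderiv ℝ ((fun z : ℝ × PhaseSpace m => (f z.1 : ℂ)) * G.1) z v = _
  rw [h2]
  simp
  ring

variable (ħ : ℝ) (K : Matrix (Fin m ⊕ Fin m) (Fin m ⊕ Fin m) ℂ)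

theorem mulTime_mul_starGen {f f' : ℝ → ℝ} (hf : AnalyticOnNhd ℝ f Set.univ)
    (hf' : AnalyticOnNhd ℝ f' Set.univ) (h : ∀ t, HasDerivAt f (f' t) t) (i : Fin m ⊕ Fin m) :
    mulTime f hf * starGen ħ K i = starGen ħ K i * mulTime f hf := by
  have h1 : mulTime f hf * coordMul i = coordMul (m := m) i * mulTime f hf :=
    LinearMap.ext fun G => ext fun z => by simp [mul_left_comm]
  have h2 : ∀ e : PhaseSpace m, dir (0, e) * mulTime f hf = mulTime f hf * dir (0, e) := fun e => by
    simp [dir_mul_mulTime hf hf' h]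
  have h3 : mulTime f hf * contrDeriv ħ K i = contrDeriv ħ K i * mulTime f hf := by
    simp only [contrDeriv, smul_mul_assoc, mul_smul_comm, Finset.sum_mul, Finset.mul_sum, h2]
  rw [starGen, mul_add, add_mul, h1, h3]

theorem mulTime_mul_starQuad {f f' : ℝ → ℝ} (hf : AnalyticOnNhd ℝ f Set.univ)
    (hf' : AnalyticOnNhd ℝ f' Set.univ) (hd : ∀ t, HasDerivAt f (f' t) t) (k : Fin m) (a b c : ℂ) :
    mulTime f hf * starQuad ħ K k a b c = starQuad ħ K k a b c * mulTime f hf := by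
  have h : ∀ i j, mulTime f hf * (starGen ħ K i * starGen ħ K j) =
      starGen ħ K i * starGen ħ K j * mulTime f hf := fun i j => by
    rw [← mul_assoc, mulTime_mul_starGen ħ K hf hf' hd, mul_assoc,
      mulTime_mul_starGen ħ K hf hf' hd, mul_assoc]
  simp only [starQuad, weylQuad, mul_smul_comm, smul_mul_assoc, mul_add, add_mul, h]

/-- Left star multiplication by the quadratic form attached to a vector of `ℝ³`. -/
noncomputable def sphereQuad (k : Fin m) (n : Fin 3 → ℝ) : Module.End ℂ (analyticFun m) :=
  starQuad ħ K k (n 0 + n 1 * Complex.I) (n 0 - n 1 * Complex.I) (n 2 * Complex.I)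

theorem sphereQuad_add (k : Fin m) (x y : ℝ) (n n' : Fin 3 → ℝ) :
    sphereQuad ħ K k (x • n + y • n') =
      (x : ℂ) • sphereQuad ħ K k n + (y : ℂ) • sphereQuad ħ K k n' := by
  simp only [sphereQuad, starQuad, weylQuad, Pi.add_apply, Pi.smul_apply, smul_eq_mul,
    Complex.ofReal_add, Complex.ofReal_mul]
  module

theorem sphereQuad_neg (k : Fin m) (n : Fin 3 → ℝ) :
    sphereQuad ħ K k (-n) = (-1 : ℂ) • sphereQuad ħ K k n := by
  simpa using sphereQuad_add ħ K k (-1) 0 n 0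

variable {ħ K}

open Matrix in
theorem sphereQuad_comm (hħ : ħ ≠ 0) (hK : K.IsSymm) (k : Fin m) (n n' : Fin 3 → ℝ) :
    sphereQuad ħ K k n * sphereQuad ħ K k n' = sphereQuad ħ K k n' * sphereQuad ħ K k n +
      (4 : ℂ) • sphereQuad ħ K k (n ⨯₃ n') := by
  have hκ : (Complex.I * ħ : ℂ) ≠ 0 := mul_ne_zero Complex.I_ne_zero (by exact_mod_cast hħ)
  simp only [sphereQuad, starQuad, smul_mul_assoc, mul_smul_comm]
  rw [weylQuad_comm (starGen_comm ħ K hK k), smul_add, smul_add]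
  congr 1
  rw [smul_smul _ (Complex.I * ħ : ℂ), inv_mul_cancel₀ hκ, one_smul, smul_comm]
  congr 1
  have hI := Complex.I_sq
  simp only [weylQuad, smul_add, smul_smul, cross_apply]
  simp only [cons_val_zero, cons_val_one, cons_val, Complex.ofReal_sub, Complex.ofReal_mul]
  congr 1
  · congr 1 <;> congr 1 <;> ring_nf <;> simp only [hI] <;> ring
  · congr 1 <;> ring_nf

theorem sphereQuad_casimir (hħ : ħ ≠ 0) (hK : K.IsSymm) (k : Fin m) (G : analyticFun m) :
    ∑ i : Fin 3, sphereQuad ħ K k (Pi.single i 1) (sphereQuad ħ K k (Pi.single i 1) G) =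
      (3 : ℂ) • G := by
  have hκ : (Complex.I * ħ : ℂ) ≠ 0 := mul_ne_zero Complex.I_ne_zero (by exact_mod_cast hħ)
  have h := congrArg (fun A => ((Complex.I * ħ : ℂ)⁻¹ ^ 2 • A : Module.End ℂ (analyticFun m)) G)
    (weylQuad_casimir (R := Module.End ℂ (analyticFun m)) (starGen_comm ħ K hK k))
  have e : (Complex.I * ħ : ℂ)⁻¹ ^ 2 * (3 * (Complex.I * ħ) ^ 2) = 3 := by
    rw [mul_left_comm, ← mul_pow, inv_mul_cancel₀ hκ]; norm_num
  simp only [smul_smul, e, smul_add] at h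
  simp only [LinearMap.smul_apply, Module.End.one_apply] at h
  rw [← h]
  simp [Fin.sum_univ_three, sphereQuad, starQuad, smul_smul, pow_two]

open Matrix in
/-- The evolution generated by `v` intertwines the quadratic form of `n` and that of the rotated
vector. -/
theorem evolution_sphereQuad (hħ : ħ ≠ 0) (hK : K.IsSymm) (k : Fin m) {v n : Fin 3 → ℝ}
    (hv : v ⬝ᵥ v = 1) (hvn : v ⬝ᵥ n = 0) {G Ω : analyticFun m}
    (hG : dir (1, 0) G = sphereQuad ħ K k v G) (hΩ : dir (1, 0) Ω = sphereQuad ħ K k v Ω)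
    (h0 : ∀ u, Ω.1 (0, u) = (sphereQuad ħ K k n G).1 (0, u)) (t : ℝ) (u : PhaseSpace m) :
    Ω.1 (t, u) = (sphereQuad ħ K k (perpRot v n (4 * t)) G).1 (t, u) := by
  have ac : AnalyticOnNhd ℝ (fun t => Real.cos (4 * t)) Set.univ := fun t _ =>
    Real.analyticAt_cos.comp (analyticAt_const.mul analyticAt_id)
  have as : AnalyticOnNhd ℝ (fun t => Real.sin (4 * t)) Set.univ := fun t _ =>
    Real.analyticAt_sin.comp (analyticAt_const.mul analyticAt_id)
  have ac' : AnalyticOnNhd ℝ (fun t => -4 * Real.sin (4 * t)) Set.univ := fun t ht =>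
    analyticAt_const.mul (as t ht)
  have as' : AnalyticOnNhd ℝ (fun t => 4 * Real.cos (4 * t)) Set.univ := fun t ht =>
    analyticAt_const.mul (ac t ht)
  have h4 : ∀ t : ℝ, HasDerivAt (fun t : ℝ => 4 * t) 4 t := fun t => by
    simpa using (hasDerivAt_id t).const_mul 4
  have dc : ∀ t, HasDerivAt (fun t => Real.cos (4 * t)) (-4 * Real.sin (4 * t)) t := fun t => by
    simpa [mul_comm] using (h4 t).cos
  have ds : ∀ t, HasDerivAt (fun t => Real.sin (4 * t)) (4 * Real.cos (4 * t)) t := fun t => by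
    simpa [mul_comm] using (h4 t).sin
  set C : Module.End ℂ (analyticFun m) := mulTime _ ac with hC
  set S : Module.End ℂ (analyticFun m) := mulTime _ as with hS
  have eC : dir (1, 0) * C = C * dir (1, 0) + (-4 : ℂ) • S := by
    rw [hC, dir_mul_mulTime ac ac' dc]
    congr 1
    refine LinearMap.ext fun G => ext fun z => ?_
    simp [hS, mul_assoc]
  have eS : dir (1, 0) * S = S * dir (1, 0) + (4 : ℂ) • C := by
    rw [hS, dir_mul_mulTime as as' ds]
    congr 1
    refine LinearMap.ext fun G => ext fun z => ?_
    simp [hC, mul_assoc]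
  set X := sphereQuad ħ K k with hX
  have cC : C * X v = X v * C := mulTime_mul_starQuad ħ K ac ac' dc k _ _ _
  have cS : S * X v = X v * S := mulTime_mul_starQuad ħ K as as' ds k _ _ _
  have dX : ∀ n, dir (1, 0) * X n = X n * dir (1, 0) := fun n =>
    dir_time_mul_starQuad ħ K k _ _ _
  have b1 : X v * X n = X n * X v + (4 : ℂ) • X (v ⨯₃ n) := sphereQuad_comm hħ hK k v n
  have b2 : X v * X (v ⨯₃ n) = X (v ⨯₃ n) * X v + (-4 : ℂ) • X n := by
    have hvvn : v ⨯₃ (v ⨯₃ n) = -n := by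
      rw [cross_cross_eq_smul_sub_smul', hv, hvn]
      simp
    rw [hX, sphereQuad_comm hħ hK k v (v ⨯₃ n), hvvn, sphereQuad_neg, smul_smul]
    norm_num
  -- `Y` is the form of the rotated vector with time-dependent coefficients. It commutes with `d/dt
  -- - X v`, so it maps solutions to solutions; `Y G` and `Ω` then agree because they agree at time
  -- `0`.
  set Y := C * X n + S * X (v ⨯₃ n) with hY
  have key : dir (1, 0) * Y + Y * X v = X v * Y + Y * dir (1, 0) := by
    have l1 : dir (1, 0) * (C * X n) = C * X n * dir (1, 0) + (-4 : ℂ) • (S * X n) := by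
      rw [← mul_assoc, eC, add_mul, mul_assoc, dX, smul_mul_assoc, mul_assoc]
    have l2 : dir (1, 0) * (S * X (v ⨯₃ n)) =
        S * X (v ⨯₃ n) * dir (1, 0) + (4 : ℂ) • (C * X (v ⨯₃ n)) := by
      rw [← mul_assoc, eS, add_mul, mul_assoc, dX, smul_mul_assoc, mul_assoc]
    have r1 : X v * (C * X n) = C * X n * X v + (4 : ℂ) • (C * X (v ⨯₃ n)) := by
      rw [← mul_assoc, ← cC, mul_assoc, b1, mul_add, mul_smul_comm, mul_assoc]
    have r2 : X v * (S * X (v ⨯₃ n)) = S * X (v ⨯₃ n) * X v + (-4 : ℂ) • (S * X n) := by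
      rw [← mul_assoc, ← cS, mul_assoc, b2, mul_add, mul_smul_comm, mul_assoc]
    rw [hY, mul_add, mul_add, l1, l2, r1, r2, add_mul, add_mul]
    module
  have hYG : dir (1, 0) (Y G) = X v (Y G) := by
    have := congrArg (fun A => A G) key
    simp only [LinearMap.add_apply, Module.End.mul_apply, hG] at this
    exact add_right_cancel this
  have hW : Y G - Ω = 0 := by
    refine eq_zero_of_evolution ħ K k (v 0 + v 1 * Complex.I) (v 0 - v 1 * Complex.I)
      (v 2 * Complex.I) (fun u => ?_) ?_
    · simp [hY, hC, hS, h0]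
    · change dir (1, 0) _ = X v _
      rw [map_sub, map_sub, hΩ, hYG]
  rw [sub_eq_zero] at hW
  rw [← hW, perpRot, hX, sphereQuad_add]
  rfl

end analyticFun

/-! ### From star exponentials to a sphere representation -/

section starEvolution

variable {m : ℕ} {ħ : ℝ} {K : Matrix (Fin m ⊕ Fin m) (Fin m ⊕ Fin m) ℂ}

namespace IsStarExp

variable {H F : PhaseSpace m → ℂ} {Φ : ℝ → PhaseSpace m → ℂ}

/-- The solution as an analytic function of time and phase space. -/
def toAnalyticFun (h : IsStarExp ħ K H F Φ) : analyticFun m :=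
  ⟨fun z => Φ z.1 z.2, h.analytic⟩

theorem differentiable_initial (h : IsStarExp ħ K H F Φ) : Differentiable ℂ F :=
  h.initial ▸ h.entire 0

theorem analytic_initial (h : IsStarExp ħ K H F Φ) : AnalyticOnNhd ℝ F Set.univ := by
  rw [← h.initial]
  exact fun u _ => AnalyticAt.comp (g := fun z : ℝ × PhaseSpace m => Φ z.1 z.2)
    (f := fun u : PhaseSpace m => ((0 : ℝ), u)) (h.analytic (0, u) trivial)
    (AnalyticAt.prod analyticAt_const analyticAt_id)

theorem dir_toAnalyticFun {k : Fin m} {a b c : ℂ}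
    (h : IsStarExp ħ K (quadForm ħ K k a b c) F Φ) :
    analyticFun.dir (1, 0) h.toAnalyticFun =
      analyticFun.starQuad ħ K k a b c h.toAnalyticFun := by
  refine analyticFun.ext fun z => ?_
  obtain ⟨t, u⟩ := z
  rw [← analyticFun.starMul_quadForm ħ K k a b c h.toAnalyticFun t (h.entire t) u]
  exact (analyticFun.deriv_time h.toAnalyticFun t u).unique (h.evolution t u)

end IsStarExp

/-- A function on phase space as a function constant in time. -/
def constInTime (F : PhaseSpace m → ℂ) (hF : AnalyticOnNhd ℝ F Set.univ) : analyticFun m :=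
  ⟨fun z => F z.2, fun z _ => (hF z.2 trivial).comp analyticAt_snd⟩

theorem starMul_eq_constInTime {F : PhaseSpace m → ℂ} (hF : AnalyticOnNhd ℝ F Set.univ)
    (hd : Differentiable ℂ F) (k : Fin m) (a b c : ℂ) (z : ℝ × PhaseSpace m) :
    starMul ħ K (quadForm ħ K k a b c) F z.2 =
      (analyticFun.starQuad ħ K k a b c (constInTime F hF)).1 z :=
  analyticFun.starMul_quadForm ħ K k a b c (constInTime F hF) z.1 hd z.2

end starEvolution

theorem mainTheorem10 {m : ℕ} (ħ : ℝ) (hħ : 0 < ħ)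
    (K : Matrix (Fin m ⊕ Fin m) (Fin m ⊕ Fin m) ℂ) (hK : K.IsSymm)
    (ϖ : PhaseSpace m → ℂ) (hϖ : IsVacuum ħ K ϖ) (k : Fin m)
    (𝓗 : Type*) [NormedAddCommGroup 𝓗] [InnerProductSpace ℂ 𝓗] [CompleteSpace 𝓗]
    [Nontrivial 𝓗] :
    ¬ ∃ (D : Submodule ℂ (PhaseSpace m → ℂ)) (ι : D →ₗ[ℂ] 𝓗),
      IsRegularHilbertSpace ħ K ϖ D ι ∧
      ∀ a b c : ℂ, a * b - c ^ 2 = 1 →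
        IsRegularlyRepresented ħ K (quadForm ħ K k a b c) D ι := by
  rintro ⟨D, ι, hD, hrep⟩
  set q : (Fin 3 → ℝ) → PhaseSpace m → ℂ := fun n => quadForm ħ K k (n 0 + n 1 * Complex.I)
    (n 0 - n 1 * Complex.I) (n 2 * Complex.I) with hq
  have H : ∀ n : Fin 3 → ℝ, ∃ (U : ℝ → 𝓗 →L[ℂ] 𝓗) (T : D → D) (Φ : D → ℝ → D), dotProduct n n = 1 →
      IsContGroup U ∧ (∀ F : D, IsStarExp ħ K (q n) (F : PhaseSpace m → ℂ) fun t => Φ F t) ∧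
      (∀ F t, U t (ι F) = ι (Φ F t)) ∧
      (∀ F, (T F : PhaseSpace m → ℂ) = starMul ħ K (q n) F) ∧
      (∀ F, HasDerivAt (fun t => U t (ι F)) (ι (T F)) 0) := by
    intro n
    by_cases hn : dotProduct n n = 1
    · have habc : ((n 0 : ℂ) + n 1 * Complex.I) * (n 0 - n 1 * Complex.I) -
          (n 2 * Complex.I) ^ 2 = 1 := by
        have h1 : ((n 0 * n 0 + n 1 * n 1 + n 2 * n 2 : ℝ) : ℂ) = 1 := by
          rw [← Complex.ofReal_one, ← hn]
          simp [dotProduct, Fin.sum_univ_three]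
        push_cast at h1
        linear_combination h1 - ((n 1 : ℂ) ^ 2 + (n 2 : ℂ) ^ 2) * Complex.I_sq
      obtain ⟨U, h0, hadd, hcont, hΦ, hT⟩ := hrep _ _ _ habc
      choose Φ hΦ using hΦ
      choose T hT using hT
      exact ⟨U, T, Φ, fun _ => ⟨⟨h0, hadd, hcont⟩, fun F => (hΦ F).1, fun F => (hΦ F).2,
        fun F => (hT F).1, fun F => (hT F).2⟩⟩
    · exact ⟨fun _ => 0, fun F => F, fun F _ => F, fun h => absurd h hn⟩
  choose U T Φ H using H
  have hexp : ∀ n, dotProduct n n = 1 → ∀ F : D, IsStarExp ħ K (q n) (F : PhaseSpace m → ℂ)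
    fun t => Φ n F t := fun n hn => (H n hn).2.1
  have hT : ∀ n, dotProduct n n = 1 → ∀ F : D, (T n F : PhaseSpace m → ℂ) = starMul ħ K (q n) F :=
    fun n hn => (H n hn).2.2.2.1
  -- Any one unit vector suffices here: each element of `D` is the initial value of a star
  -- evolution, hence analytic and entire.
  have e0 := IsSphereRep.single_dotProduct_self 0
  have han : ∀ F : D, AnalyticOnNhd ℝ (F : PhaseSpace m → ℂ) Set.univ :=
    fun F => (hexp _ e0 F).analytic_initial
  have hdi : ∀ F : D, Differentiable ℂ (F : PhaseSpace m → ℂ) :=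
    fun F => (hexp _ e0 F).differentiable_initial
  set C : D → analyticFun m := fun F => constInTime F (han F) with hC
  have hTC : ∀ n, dotProduct n n = 1 → ∀ F : D, C (T n F) = analyticFun.sphereQuad ħ K k n (C F) := by
    refine fun n hn F => analyticFun.ext fun z => ?_
    change (T n F : PhaseSpace m → ℂ) z.2 = _
    rw [hT n hn]
    exact starMul_eq_constInTime (han F) (hdi F) k _ _ _ z
  have hCinj : ∀ F G : D, C F = C G → F = G := fun F G h => Subtype.ext <| funext fun u =>
    congrFun (congrArg Subtype.val h) (0, u)
  refine IsSphereRep.not_nontrivial (ι := ι) (U := U) (T := T) (Φ := Φ)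
    { dense := hD.dense
      group := fun n hn => (H n hn).1
      orbit := fun n hn => (H n hn).2.2.1
      deriv := fun n hn => (H n hn).2.2.2.2
      neg := fun n hn F => ?_
      intertwine := fun v a hv ha hva F t => ?_
      casimir := fun F => ?_ }
  · rw [← map_neg]
    refine congrArg ι (hCinj _ _ ?_)
    rw [hTC _ (by simpa using hn), analyticFun.sphereQuad_neg, LinearMap.smul_apply, ← hTC n hn]
    refine analyticFun.ext fun z => ?_
    simp [hC, constInTime]
  · refine congrArg ι (Subtype.ext (funext fun u => ?_))
    rw [hT _ (perpRot_dotProduct_self hv ha hva _)]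
    have hF := hexp v hv F
    have hΩ := hexp v hv (T a F)
    have := analyticFun.evolution_sphereQuad hħ.ne' hK k hv hva hF.dir_toAnalyticFun
      hΩ.dir_toAnalyticFun (fun u => ?_) t u
    · refine this.trans (analyticFun.starMul_quadForm ħ K k _ _ _ hF.toAnalyticFun t
        (hF.entire t) u).symm
    · have h1 : hΩ.toAnalyticFun.1 (0, u) = (T a F : PhaseSpace m → ℂ) u :=
        congrFun hΩ.initial u
      have h2 := analyticFun.starMul_quadForm ħ K k (a 0 + a 1 * Complex.I)
        (a 0 - a 1 * Complex.I) (a 2 * Complex.I) hF.toAnalyticFun 0 (hF.entire 0) u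
      have h3 : (fun u => hF.toAnalyticFun.1 (0, u)) = (F : PhaseSpace m → ℂ) := hF.initial
      rw [h1, hT a ha]
      rw [h3] at h2
      exact h2
  · have h1 : ∑ i : Fin 3, T (Pi.single i 1) (T (Pi.single i 1) F) = (3 : ℂ) • F := by
      refine hCinj _ _ (analyticFun.ext fun z => ?_)
      have h2 := congrArg (fun G : analyticFun m => G.1 z)
        (analyticFun.sphereQuad_casimir hħ.ne' hK k (C F))
      simp only [← hTC _ (IsSphereRep.single_dotProduct_self _)] at h2
      simpa [hC, constInTime, Fin.sum_univ_three] using h2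
    rw [← map_sum, h1, map_smul]
    norm_cast
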